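/- Notation. For a closed, convex, nonempty set $K\subseteq\mathbb{R}^n$ and $\sigma>0$, observe $Y\sim N(\mu,\sigma^2\mathbb{I}_n)$ with unknown $\mu\in K$, and let $\hat\mu(Y)=\operatorname{argmin}_{\nu\in K}\|Y-\nu\|^2$ be the least squares estimator (LSE). For $\mu\in K$ and $\varepsilon>0$ let $w_\mu(\varepsilon)=\mathbb{E}\sup_{t\in B(\mu,\varepsilon)\cap K}\langle x,t\rangle$ with $x\sim N(0,\mathbb{I}_n)$, where $B(\mu,\varepsilon)$ is the closed Euclidean ball. For a constant $c^*>0$ let $M^{\mathrm{loc}}(\varepsilon)$ be the supremum over $\theta\in K$ of the largest cardinality of a subset of $B(\theta,\varepsilon)\cap K$ whose distinct points are at distance $>\varepsilon/c^*$, and let $\varepsilon^*(\sigma)=\sup\{\varepsilon\ge 0:\varepsilon^2/\sigma^2\le\log M^{\mathrm{loc}}(\varepsilon)\}$. Say that the LSE is minimax optimal with constant $A$ if $$\sup_{\mu\in K}\mathbb{E}_\mu\|\hat\mu(Y)-\mu\|^2\le A\,\inf_{\hat\nu}\sup_{\mu\in K}\mathbb{E}_\mu\|\hat\nu(Y)-\mu\|^2,$$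 the infimum being over all measurable $\hat\nu:\mathbb{R}^n\to\mathbb{R}^n$. Say that the width map is $(\varepsilon/\sigma)$-Lipschitz with constants $(a,L)$ if, for every $\varepsilon>0$ with $\varepsilon\ge a\,\varepsilon^*(\sigma)$, the map $\mu\mapsto w_\mu(\varepsilon)$ is Lipschitz on $K$ with constant $L\varepsilon/\sigma$. Statement. For every sufficiently large absolute constant $c^*$, the LSE is minimax optimal if and only if $\mu\mapsto w_\mu(\varepsilon)$ is $(\varepsilon/\sigma)$-Lipschitz on $K$, up to constants, for all $\varepsilon\gtrsim\varepsilon^*(\sigma)$. Precisely, there is an absolute constant $c_0>0$ such that for every $c^*\ge c_0$: (i) for every $A>0$ there are $a,L>0$, depending only on $A$ and $c^*$, such that for all $n$, $\sigma>0$ and closed convex nonempty $K\subseteq\mathbb{R}^n$, if the LSE is minimax optimal with constant $A$, then the width map is $(\varepsilon/\sigma)$-Lipschitz with constants $(a,L)$; (ii) for all $a,L>0$ there is $A>0$, depending only on $a$, $L$ and $c^*$, such that for all $n$, $\sigma>0$ and closed convex nonempty $K\subseteq\mathbb{R}^n$, if the width map is $(\varepsilon/\sigma)$-Lipschitz with constants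 $(a,L)$, then the LSE is minimax optimal with constant $A$. -/

import Mathlib

open MeasureTheory ProbabilityTheory Set
open scoped ENNReal NNReal RealInnerProductSpace

noncomputable section

namespace GaussianSequence

/-- The Euclidean space `ℝⁿ`. -/
abbrev Euc (n : ℕ) : Type := EuclideanSpace ℝ (Fin n)

/-- The law `N(μ, σ² Iₙ)` of the observation `Y = μ + ξ`, `ξ = σ z` with `z ∼ N(0, Iₙ)`. -/
def obsLaw {n : ℕ} (σ : ℝ) (μ : Euc n) : Measure (Euc n) :=
  (stdGaussian (Euc n)).map (fun z => μ + σ • z)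

/-- The least squares estimator over `K`: a minimizer of `ν ↦ ‖y - ν‖²` over `K`. For `K` closed,
convex and nonempty there is exactly one (`lse_spec`, `lse_unique`). -/
def lse {n : ℕ} (K : Set (Euc n)) (y : Euc n) : Euc n :=
  Classical.epsilon fun p => p ∈ K ∧ ∀ ν ∈ K, ‖y - p‖ ^ 2 ≤ ‖y - ν‖ ^ 2

theorem lse_spec {n : ℕ} {K : Set (Euc n)} (hK : IsClosed K) (hne : K.Nonempty) (y : Euc n) :
    lse K y ∈ K ∧ ∀ ν ∈ K, ‖y - lse K y‖ ^ 2 ≤ ‖y - ν‖ ^ 2 := by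
  apply Classical.epsilon_spec (p := fun p => p ∈ K ∧ ∀ ν ∈ K, ‖y - p‖ ^ 2 ≤ ‖y - ν‖ ^ 2)
  obtain ⟨p, hp, h⟩ := hK.exists_infDist_eq_dist hne y
  refine ⟨p, hp, fun ν hν => ?_⟩
  have h2 : dist y p ≤ dist y ν := h ▸ Metric.infDist_le_dist_of_mem hν
  rw [dist_eq_norm, dist_eq_norm] at h2
  gcongr

theorem lse_unique {n : ℕ} {K : Set (Euc n)} (hK : IsClosed K) (hc : Convex ℝ K) {y p : Euc n}
    (hp : p ∈ K) (h : ∀ ν ∈ K, ‖y - p‖ ^ 2 ≤ ‖y - ν‖ ^ 2) : p = lse K y := by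
  obtain ⟨hq, h'⟩ := lse_spec hK ⟨p, hp⟩ y
  set q := lse K y
  have hm : (1 / 2 : ℝ) • p + (1 / 2 : ℝ) • q ∈ K :=
    hc hp hq (by norm_num) (by norm_num) (by norm_num)
  have e1 := h _ hm
  have e2 := h' _ hm
  have par := parallelogram_law_with_norm ℝ (y - p) (y - q)
  have a1 : (y - p) + (y - q) = (2 : ℝ) • (y - ((1 / 2 : ℝ) • p + (1 / 2 : ℝ) • q)) := by
    module
  have a2 : (y - p) - (y - q) = q - p := by abel
  rw [a1, a2, norm_smul, Real.norm_eq_abs, abs_of_pos (by norm_num : (0 : ℝ) < 2)] at par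
  have h0 : ‖q - p‖ = 0 := by
    have := norm_nonneg (q - p)
    nlinarith
  exact (sub_eq_zero.mp (norm_eq_zero.mp h0)).symm

/-- Worst case risk `sup_{μ ∈ K} E_μ ‖δ(Y) - μ‖²` over `K` of an estimator `δ`, in `[0, ∞]`. -/
def worstRisk {n : ℕ} (σ : ℝ) (K : Set (Euc n)) (δ : Euc n → Euc n) : ℝ≥0∞ :=
  ⨆ μ ∈ K, ∫⁻ y, ‖δ y - μ‖ₑ ^ 2 ∂(obsLaw σ μ)

/-- The minimax risk over `K`: infimum of the worst case risk over all measurable estimators. -/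
def minimaxRisk {n : ℕ} (σ : ℝ) (K : Set (Euc n)) : ℝ≥0∞ :=
  ⨅ (δ : Euc n → Euc n) (_ : Measurable δ), worstRisk σ K δ

/-- The LSE is minimax optimal over `K` at noise level `σ`, up to the constant factor `A`. -/
def LSEOptimal {n : ℕ} (A σ : ℝ) (K : Set (Euc n)) : Prop :=
  worstRisk σ K (lse K) ≤ ENNReal.ofReal A * minimaxRisk σ K

/-- The Gaussian width `E sup_{t ∈ T} ⟪x, t⟫`, `x ∼ N(0, Iₙ)`, of a nonempty bounded set `T`. -/
def gaussianWidth {n : ℕ} (T : Set (Euc n)) : ℝ :=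
  ∫ x, ⨆ t : T, ⟪x, (t : Euc n)⟫ ∂(stdGaussian (Euc n))

/-- The local Gaussian width `w_μ(ε)` of `K` at `μ`. -/
def localWidth {n : ℕ} (K : Set (Euc n)) (μ : Euc n) (ε : ℝ) : ℝ :=
  gaussianWidth (Metric.closedBall μ ε ∩ K)

/-- The largest cardinality `M^loc(ε)` of an `(ε / c)`-packing (pairwise distances `> ε / c`) of a
set `B(θ, ε) ∩ K` with `θ ∈ K`. -/
def localPacking {n : ℕ} (c : ℝ) (K : Set (Euc n)) (ε : ℝ) : ℕ∞ :=
  ⨆ θ ∈ K, Metric.packingNumber (ε / c).toNNReal (Metric.closedBall θ ε ∩ K)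

/-- The local packing number is finite, so that no information is lost by `ENat.toNat` below. -/
theorem localPacking_ne_top {n : ℕ} {c : ℝ} (hc : 0 < c) (K : Set (Euc n)) {ε : ℝ} (hε : 0 ≤ ε) :
    localPacking c K ε ≠ ⊤ := by
  rcases hε.eq_or_lt with rfl | hε
  · have : localPacking c K 0 ≤ 1 := by
      refine iSup₂_le fun θ _ => ?_
      refine (Metric.packingNumber_le_encard_self _).trans ?_
      rw [Metric.closedBall_zero]
      exact (Set.encard_le_encard Set.inter_subset_left).trans (by simp)
    exact ne_top_of_le_ne_top (by simp) this
  · set r : ℝ≥0 := (ε / c).toNNReal / 2 with hr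
    have hr0 : r ≠ 0 := by
      have : 0 < (ε / c).toNNReal := Real.toNNReal_pos.mpr (by positivity)
      positivity
    have h2 : 2 * r = (ε / c).toNNReal := by
      rw [hr]; field_simp
    obtain ⟨N, -, hN, hcov⟩ := Metric.exists_finite_isCover_of_isCompact (ε := r) hr0
      (isCompact_closedBall (0 : Euc n) ε)
    have : localPacking c K ε ≤ N.encard := by
      refine iSup₂_le fun θ _ => ?_
      rw [← h2]
      refine (Metric.packingNumber_two_mul_le_externalCoveringNumber r _).trans ?_
      refine (Metric.externalCoveringNumber_mono_set Set.inter_subset_left).trans ?_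
      have hcov' : Metric.IsCover r (Metric.closedBall θ ε) ((fun x => θ + x) '' N) := by
        intro x hx
        obtain ⟨y, hy, hxy⟩ := hcov (x := x - θ) (by
          simpa [dist_eq_norm] using hx)
        refine ⟨θ + y, ⟨y, hy, rfl⟩, ?_⟩
        have : edist x (θ + y) = edist (x - θ) y := by
          rw [edist_eq_enorm_sub, edist_eq_enorm_sub, sub_sub]
        change edist x (θ + y) ≤ r
        rw [this]
        exact hxy
      exact hcov'.externalCoveringNumber_le_encard.trans (Set.encard_image_le _ _)
    exact ne_top_of_le_ne_top hN.encard_lt_top.ne this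

/-- The local entropy `log M^loc(ε)`. -/
def localEntropy {n : ℕ} (c : ℝ) (K : Set (Euc n)) (ε : ℝ) : ℝ :=
  Real.log ((localPacking c K ε).toNat : ℝ)

/-- `ε*(σ) = sup {ε ≥ 0 : ε² / σ² ≤ log M^loc(ε)}`. -/
def epsStar {n : ℕ} (c σ : ℝ) (K : Set (Euc n)) : ℝ :=
  sSup {ε : ℝ | 0 ≤ ε ∧ ε ^ 2 / σ ^ 2 ≤ localEntropy c K ε}

/-- The map `μ ↦ w_μ(ε)` is `L (ε / σ)`-Lipschitz on `K` for all `ε > 0` with `ε ≥ a ε*(σ)`. -/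
def WidthLipschitz {n : ℕ} (c a L σ : ℝ) (K : Set (Euc n)) : Prop :=
  ∀ ε : ℝ, 0 < ε → a * epsStar c σ K ≤ ε →
    LipschitzOnWith (L * (ε / σ)).toNNReal (fun μ => localWidth K μ ε) K

end GaussianSequence

end

/-! For μ ∈ K let h_μ(s) be the supremum of ⟪z, t - μ⟫ over t ∈ K with ‖t - μ‖ ≤ s (`localSup`); its
Gaussian mean is w_μ(s). Three facts drive the proof. The distance from the LSE to μ maximizes σ
h_μ(s) - s²/2 (`lse_localSup`). Convexity of K makes h_μ concave in s (`localSup_concave`). The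
fluctuations of h_μ(s) are O(s) in every dimension (`HasSubgradients.integral_sq_centered_le`).
Hence a risk of order ε*² for the LSE corresponds to increments w_μ(ε) - w_μ(r) of order ε²/σ at
radii above ε* (`localWidth_sub_le_of_worstRisk_le`, `lintegral_lse_le`).

The minimax risk is of order ε*²: from below by a packing argument
(`ofReal_epsStar_sq_le_minimaxRisk`), from above, when σ ≤ ε*, by a sieve estimator
(`minimaxRisk_le`). If ε* < σ, then K has diameter at most ε* (`dist_le_epsStar_of_lt`) and both
directions are immediate.

Optimality implies Lipschitz: the risk bound controls an increment of w_μ below ε, concavity turns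
it into a slope bound beyond ε, and B(ν, ε) ⊆ B(μ, ε + ‖ν - μ‖) turns the slope in the radius into a
Lipschitz constant in μ.

Lipschitz implies optimality: cover B(μ, ε) ∩ K by at most exp(ε²/σ²) balls of radius ε/c. The
Lipschitz property makes their widths comparable with w_μ(ε/c), and a maximal inequality bounds the
width of the union (`localWidth_sub_le_of_lipschitz`). -/

namespace GaussianSequence

/-! ### Dimension-free Gaussian concentration for convex Lipschitz functions. -/

section Concentration

variable {E : Type*} [NormedAddCommGroup E] [InnerProductSpace ℝ E]

/-- Every point has a subgradient of norm at most `R`: the function is convex and `R`-Lipschitz. -/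
def HasSubgradients (f : E → ℝ) (R : ℝ) : Prop :=
  ∀ x, ∃ v, ‖v‖ ≤ R ∧ ∀ y, f x - f y ≤ ⟪x - y, v⟫

theorem HasSubgradients.nonneg {f : E → ℝ} {R : ℝ} (h : HasSubgradients f R) : 0 ≤ R :=
  let ⟨_, hv, _⟩ := h 0
  (norm_nonneg _).trans hv

theorem HasSubgradients.sub_le {f : E → ℝ} {R : ℝ} (h : HasSubgradients f R) (x y : E) :
    f x - f y ≤ R * ‖x - y‖ := by
  obtain ⟨v, hv, hf⟩ := h x
  calc f x - f y ≤ ⟪x - y, v⟫ := hf y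
    _ ≤ ‖x - y‖ * ‖v‖ := real_inner_le_norm _ _
    _ ≤ ‖x - y‖ * R := by gcongr
    _ = R * ‖x - y‖ := mul_comm _ _

theorem HasSubgradients.abs_sub_le {f : E → ℝ} {R : ℝ} (h : HasSubgradients f R) (x y : E) :
    |f x - f y| ≤ R * ‖x - y‖ :=
  abs_le.mpr ⟨by have := h.sub_le y x; rw [norm_sub_rev] at this; linarith, h.sub_le x y⟩

theorem HasSubgradients.continuous {f : E → ℝ} {R : ℝ} (h : HasSubgradients f R) :
    Continuous f := by
  refine (LipschitzWith.of_dist_le_mul (K := R.toNNReal) fun x y => ?_).continuous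
  rw [Real.dist_eq, dist_eq_norm, Real.coe_toNNReal _ h.nonneg]
  exact h.abs_sub_le x y

variable [FiniteDimensional ℝ E] [MeasurableSpace E] [BorelSpace E]

theorem integrable_exp_mul_norm (s : ℝ) :
    Integrable (fun x : E => Real.exp (s * ‖x‖)) (stdGaussian E) := by
  have := FiniteDimensional.complete ℝ E
  obtain ⟨C, hC, hi⟩ := IsGaussian.exists_integrable_exp_sq (stdGaussian E)
  refine (hi.const_mul (Real.exp (s ^ 2 / (4 * C)))).mono' (by fun_prop) (ae_of_all _ fun x => ?_)
  rw [Real.norm_eq_abs, abs_of_pos (Real.exp_pos _), ← Real.exp_add]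
  gcongr
  have h := sq_nonneg (2 * C * ‖x‖ - s)
  have e : s ^ 2 / (4 * C) + C * ‖x‖ ^ 2 - s * ‖x‖ = (2 * C * ‖x‖ - s) ^ 2 / (4 * C) := by
    field_simp
    ring
  have : 0 ≤ (2 * C * ‖x‖ - s) ^ 2 / (4 * C) := by positivity
  linarith

theorem integral_exp_inner (v : E) :
    ∫ x, Real.exp ⟪x, v⟫ ∂(stdGaussian E) = Real.exp (‖v‖ ^ 2 / 2) := by
  have h := IsGaussian.map_eq_gaussianReal (μ := stdGaussian E) (innerSL ℝ v)
  have h2 := mgf_gaussianReal h 1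
  rw [integral_strongDual_stdGaussian, variance_dual_stdGaussian, innerSL_apply_norm] at h2
  simp only [mgf, one_mul, zero_add, one_pow, mul_one] at h2
  rw [Real.coe_toNNReal _ (by positivity)] at h2
  rw [← h2]
  simp only [innerSL_apply_apply, real_inner_comm]

theorem map_rotation_stdGaussian (θ : ℝ) :
    ((stdGaussian E).prod (stdGaussian E)).map (ContinuousLinearMap.rotation θ) =
      (stdGaussian E).prod (stdGaussian E) :=
  have := FiniteDimensional.complete ℝ E
  IsGaussian.map_rotation_eq_self_of_forall_strongDual_eq_zero integral_strongDual_stdGaussian θ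

theorem integrable_exp_mul_norm_prod (s t : ℝ) :
    Integrable (fun p : E × E => Real.exp (s * ‖p.1‖ + t * ‖p.2‖))
      ((stdGaussian E).prod (stdGaussian E)) := by
  simp only [Real.exp_add]
  exact (integrable_exp_mul_norm s).mul_prod (integrable_exp_mul_norm t)

/-- Exponential moment of the increment of `f` under a rotation by the angle `d`. -/
theorem integrable_exp_rotation_increment {f : E → ℝ} {R : ℝ} (hf : HasSubgradients f R)
    {s : ℝ} (hs : 0 ≤ s) (d : ℝ) :
    Integrable (fun p : E × E => Real.exp (s * (f p.1 - f (Real.cos d • p.1 - Real.sin d • p.2))))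
      ((stdGaussian E).prod (stdGaussian E)) := by
  have hc := hf.continuous
  have hR := hf.nonneg
  refine (integrable_exp_mul_norm_prod (s * (R * 2)) (s * R)).mono' (by fun_prop)
    (ae_of_all _ fun p => ?_)
  rw [Real.norm_eq_abs, abs_of_pos (Real.exp_pos _)]
  gcongr
  have h1 := hf.sub_le p.1 (Real.cos d • p.1 - Real.sin d • p.2)
  have h2 : ‖p.1 - (Real.cos d • p.1 - Real.sin d • p.2)‖ ≤ 2 * ‖p.1‖ + ‖p.2‖ := by
    have e1 : ‖Real.cos d • p.1‖ ≤ ‖p.1‖ := by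
      rw [norm_smul]
      exact mul_le_of_le_one_left (norm_nonneg _) (Real.abs_cos_le_one d)
    have e2 : ‖Real.sin d • p.2‖ ≤ ‖p.2‖ := by
      rw [norm_smul]
      exact mul_le_of_le_one_left (norm_nonneg _) (Real.abs_sin_le_one d)
    have := norm_sub_le p.1 (Real.cos d • p.1 - Real.sin d • p.2)
    have := norm_sub_le (Real.cos d • p.1) (Real.sin d • p.2)
    linarith
  calc s * (f p.1 - f (Real.cos d • p.1 - Real.sin d • p.2)) ≤ s * (R * (2 * ‖p.1‖ + ‖p.2‖)) := by
        gcongr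
        exact h1.trans (by gcongr)
    _ = s * (R * 2) * ‖p.1‖ + s * R * ‖p.2‖ := by ring

/-- For fixed x the subgradient at x bounds the increment by a function affine in y, whose Gaussian
exponential moment is explicit. The remaining factor in ‖x‖ has rate 1 - cos d, of second order in
d. -/
theorem integral_exp_rotation_increment_le {f : E → ℝ} {R : ℝ} (hf : HasSubgradients f R)
    {s : ℝ} (hs : 0 ≤ s) (d : ℝ) :
    ∫ p : E × E, Real.exp (s * (f p.1 - f (Real.cos d • p.1 - Real.sin d • p.2)))
        ∂((stdGaussian E).prod (stdGaussian E)) ≤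
      Real.exp ((s * Real.sin d * R) ^ 2 / 2) *
        ∫ x : E, Real.exp (s * (1 - Real.cos d) * R * ‖x‖) ∂(stdGaussian E) := by
  have hc := hf.continuous
  have hR := hf.nonneg
  have hint := integrable_exp_rotation_increment hf hs d
  rw [integral_prod _ hint, ← integral_const_mul]
  refine integral_mono hint.integral_prod_left ((integrable_exp_mul_norm _).const_mul _)
    fun x => ?_
  obtain ⟨v, hv, hfv⟩ := hf x
  have hcos : 0 ≤ 1 - Real.cos d := by linarith [Real.cos_le_one d]
  have hpt : ∀ y : E, Real.exp (s * (f x - f (Real.cos d • x - Real.sin d • y))) ≤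
      Real.exp (s * (1 - Real.cos d) * R * ‖x‖) * Real.exp ⟪y, (s * Real.sin d) • v⟫ := by
    intro y
    rw [← Real.exp_add]
    gcongr
    have h1 := hfv (Real.cos d • x - Real.sin d • y)
    have e : x - (Real.cos d • x - Real.sin d • y) = (1 - Real.cos d) • x + Real.sin d • y := by
      module
    rw [e, inner_add_left, real_inner_smul_left, real_inner_smul_left] at h1
    have h2 : ⟪x, v⟫ ≤ R * ‖x‖ := (real_inner_le_norm _ _).trans (by
      rw [mul_comm]; gcongr)
    rw [real_inner_smul_right]
    calc s * (f x - f (Real.cos d • x - Real.sin d • y))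
        ≤ s * ((1 - Real.cos d) * ⟪x, v⟫ + Real.sin d * ⟪y, v⟫) := by gcongr
      _ ≤ s * ((1 - Real.cos d) * (R * ‖x‖) + Real.sin d * ⟪y, v⟫) := by gcongr
      _ = _ := by ring
  have hi2 : Integrable (fun y : E => Real.exp ⟪y, (s * Real.sin d) • v⟫) (stdGaussian E) := by
    refine (integrable_exp_mul_norm ‖(s * Real.sin d) • v‖).mono' (by fun_prop)
      (ae_of_all _ fun y => ?_)
    rw [Real.norm_eq_abs, abs_of_pos (Real.exp_pos _)]
    exact Real.exp_le_exp.mpr ((real_inner_le_norm y ((s * Real.sin d) • v)).trans_eq (mul_comm _ _))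
  calc ∫ y, Real.exp (s * (f x - f (Real.cos d • x - Real.sin d • y))) ∂(stdGaussian E)
      ≤ ∫ y, Real.exp (s * (1 - Real.cos d) * R * ‖x‖) * Real.exp ⟪y, (s * Real.sin d) • v⟫
          ∂(stdGaussian E) :=
        integral_mono_of_nonneg (ae_of_all _ fun _ => (Real.exp_pos _).le) (hi2.const_mul _)
          (ae_of_all _ hpt)
    _ = Real.exp (s * (1 - Real.cos d) * R * ‖x‖) *
          Real.exp (‖(s * Real.sin d) • v‖ ^ 2 / 2) := by
        rw [integral_const_mul, integral_exp_inner]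
    _ ≤ Real.exp (s * (1 - Real.cos d) * R * ‖x‖) *
          Real.exp ((s * Real.sin d * R) ^ 2 / 2) := by
        gcongr ?_ * Real.exp (?_ / 2)
        rw [norm_smul, mul_pow, mul_pow (s * Real.sin d), Real.norm_eq_abs, sq_abs]
        gcongr
    _ = _ := mul_comm _ _

/-- A discrete form of the Maurey–Pisier rotation argument: subgradients replace the derivative
along the path, so no smoothness is needed. -/
theorem integral_exp_sub_le_of_steps {f : E → ℝ} {R : ℝ} (hf : HasSubgradients f R)
    {l : ℝ} (hl : 0 ≤ l) (m : ℕ) (hm : 0 < m) :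
    ∫ p : E × E, Real.exp (l * (f p.2 - f p.1)) ∂((stdGaussian E).prod (stdGaussian E)) ≤
      Real.exp (2 * (l * R) ^ 2) *
        ∫ x : E, Real.exp (2 * l * R * (1 / (m : ℝ)) * ‖x‖) ∂(stdGaussian E) := by
  set P := (stdGaussian E).prod (stdGaussian E) with hP
  have hm0 : (0 : ℝ) < m := by exact_mod_cast hm
  -- After m rotations by this angle the first coordinate has moved from `p.1` to `p.2`. Jensen over
  -- the m increments costs a factor m in the exponent, and rotation invariance gives all of them
  -- the same law.
  set d : ℝ := Real.pi / 2 / m with hd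
  have hd0 : 0 ≤ d := by positivity
  have hR := hf.nonneg
  set G : E × E → ℝ := fun p => f p.1 - f (Real.cos d • p.1 - Real.sin d • p.2) with hG
  let rot : ℕ → (E × E →L[ℝ] E × E) := fun i => ContinuousLinearMap.rotation (i * d)
  have hstep : ∀ (i : ℕ) (p : E × E), G (rot (i + 1) p) = f (rot (i + 1) p).1 - f (rot i p).1 := by
    intro i p
    simp only [hG, rot]
    congr 2
    simp only [ContinuousLinearMap.rotation_apply]
    have e1 : Real.cos (i * d) = Real.cos ((i + 1 : ℕ) * d) * Real.cos d +
        Real.sin ((i + 1 : ℕ) * d) * Real.sin d := by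
      rw [← Real.cos_sub]; push_cast; ring_nf
    have e2 : Real.sin (i * d) = Real.sin ((i + 1 : ℕ) * d) * Real.cos d -
        Real.cos ((i + 1 : ℕ) * d) * Real.sin d := by
      rw [← Real.sin_sub]; push_cast; ring_nf
    rw [e1, e2]
    module
  have htel : ∀ p : E × E, f p.2 - f p.1 = ∑ i ∈ Finset.range m, G (rot (i + 1) p) := by
    intro p
    rw [Finset.sum_congr rfl fun i _ => hstep i p,
      Finset.sum_range_sub (fun i => f (rot i p).1) m]
    have e : (m : ℝ) * d = Real.pi / 2 := by rw [hd]; field_simp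
    simp [rot, ContinuousLinearMap.rotation_apply, e]
  have hjensen : ∀ p : E × E, Real.exp (l * (f p.2 - f p.1)) ≤
      ∑ i ∈ Finset.range m, (1 / (m : ℝ)) * Real.exp (m * l * G (rot (i + 1) p)) := by
    intro p
    have := convexOn_exp.map_sum_le (t := Finset.range m) (w := fun _ => 1 / (m : ℝ))
      (p := fun i => m * l * G (rot (i + 1) p)) (fun _ _ => by positivity)
      (by simp [hm0.ne']) (fun _ _ => mem_univ _)
    simp only [smul_eq_mul] at this
    refine le_of_eq_of_le ?_ this
    congr 1
    rw [htel, Finset.mul_sum]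
    exact Finset.sum_congr rfl fun i _ => by field_simp
  have hml : 0 ≤ m * l := by positivity
  have hintG : Integrable (fun p => Real.exp (m * l * G p)) P :=
    integrable_exp_rotation_increment hf hml d
  have hrot : ∀ i, MeasurePreserving (rot i) P P := fun i =>
    ⟨(rot i).continuous.measurable, map_rotation_stdGaussian _⟩
  have hGi : ∀ i, Integrable (fun p => Real.exp (m * l * G (rot (i + 1) p))) P := fun i =>
    (hrot (i + 1)).integrable_comp_of_integrable hintG
  have hGe : ∀ i, ∫ p, Real.exp (m * l * G (rot (i + 1) p)) ∂P = ∫ p, Real.exp (m * l * G p) ∂P := by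
    intro i
    have h := integral_map (μ := P) (rot (i + 1)).continuous.measurable.aemeasurable
      (f := fun p => Real.exp (m * l * G p)) (by rw [(hrot (i + 1)).map_eq]; exact hintG.1)
    rw [(hrot (i + 1)).map_eq] at h
    exact h.symm
  have hbound : ∫ p, Real.exp (l * (f p.2 - f p.1)) ∂P ≤ ∫ p, Real.exp (m * l * G p) ∂P := by
    calc ∫ p, Real.exp (l * (f p.2 - f p.1)) ∂P
        ≤ ∫ p, ∑ i ∈ Finset.range m, (1 / (m : ℝ)) * Real.exp (m * l * G (rot (i + 1) p)) ∂P :=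
          integral_mono_of_nonneg (ae_of_all _ fun _ => (Real.exp_pos _).le)
            (integrable_finsetSum _ fun i _ => (hGi i).const_mul _) (ae_of_all _ hjensen)
      _ = ∑ i ∈ Finset.range m, (1 / (m : ℝ)) * ∫ p, Real.exp (m * l * G p) ∂P := by
          rw [integral_finsetSum _ fun i _ => (hGi i).const_mul _]
          refine Finset.sum_congr rfl fun i _ => ?_
          rw [integral_const_mul, hGe]
      _ = ∫ p, Real.exp (m * l * G p) ∂P := by
          rw [Finset.sum_const, Finset.card_range, nsmul_eq_mul]
          field_simp
  refine hbound.trans ((integral_exp_rotation_increment_le hf hml d).trans ?_)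
  have hpi : Real.pi / 2 ≤ 2 := by linarith [Real.pi_le_four]
  have hmd : m * d = Real.pi / 2 := by rw [hd]; field_simp
  have hsin : |m * l * Real.sin d * R| ≤ 2 * l * R := by
    rw [abs_mul, abs_mul, abs_of_nonneg hml, abs_of_nonneg hR]
    have : |Real.sin d| ≤ d := by
      have := Real.abs_sin_le_abs (x := d)
      rwa [abs_of_nonneg hd0] at this
    calc m * l * |Real.sin d| * R ≤ m * l * d * R := by gcongr
      _ = (m * d) * l * R := by ring
      _ ≤ 2 * l * R := by rw [hmd]; gcongr
  have hcos : m * l * (1 - Real.cos d) * R ≤ 2 * l * R * (1 / (m : ℝ)) := by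
    have h1 := Real.one_sub_sq_div_two_le_cos (x := d)
    calc m * l * (1 - Real.cos d) * R ≤ m * l * (d ^ 2 / 2) * R := by gcongr; linarith
      _ = (m * d) ^ 2 / 2 * l * R * (1 / (m : ℝ)) := by field_simp
      _ ≤ 2 ^ 2 / 2 * l * R * (1 / (m : ℝ)) := by rw [hmd]; gcongr
      _ = _ := by ring
  have hsq : (m * l * Real.sin d * R) ^ 2 / 2 ≤ 2 * (l * R) ^ 2 := by
    have := sq_le_sq' (abs_le.mp hsin).1 (abs_le.mp hsin).2
    nlinarith
  refine mul_le_mul (Real.exp_le_exp.mpr hsq) ?_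
    (integral_nonneg fun _ => (Real.exp_pos _).le) (Real.exp_pos _).le
  · refine integral_mono (integrable_exp_mul_norm _) (integrable_exp_mul_norm _) fun x => ?_
    exact Real.exp_le_exp.mpr (mul_le_mul_of_nonneg_right hcos (norm_nonneg _))

/-- As the number of steps grows, the error factor in ‖x‖ tends to 1 by dominated convergence. -/
theorem integral_exp_sub_le {f : E → ℝ} {R : ℝ} (hf : HasSubgradients f R)
    {l : ℝ} (hl : 0 ≤ l) :
    ∫ p : E × E, Real.exp (l * (f p.2 - f p.1)) ∂((stdGaussian E).prod (stdGaussian E)) ≤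
      Real.exp (2 * (l * R) ^ 2) := by
  have hR := hf.nonneg
  have hlim : Filter.Tendsto
      (fun m : ℕ => ∫ x : E, Real.exp (2 * l * R * (1 / ((m : ℝ) + 1)) * ‖x‖) ∂(stdGaussian E))
      Filter.atTop (nhds (∫ _x : E, 1 ∂(stdGaussian E))) := by
    refine tendsto_integral_of_dominated_convergence (fun x => Real.exp (2 * l * R * ‖x‖))
      (fun m => by fun_prop) (integrable_exp_mul_norm _) (fun m => ae_of_all _ fun x => ?_)
      (ae_of_all _ fun x => ?_)
    · rw [Real.norm_eq_abs, abs_of_pos (Real.exp_pos _)]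
      refine Real.exp_le_exp.mpr (mul_le_mul_of_nonneg_right ?_ (norm_nonneg _))
      refine mul_le_of_le_one_right (by positivity) ?_
      rw [div_le_one (by positivity)]
      linarith [(Nat.cast_nonneg m : (0 : ℝ) ≤ m)]
    · have h := (tendsto_one_div_add_atTop_nhds_zero_nat (𝕜 := ℝ)).const_mul (2 * l * R)
      have h2 := (h.mul_const ‖x‖)
      rw [mul_zero, zero_mul] at h2
      have h3 := (Real.continuous_exp.tendsto 0).comp h2
      rwa [Real.exp_zero] at h3
  have h2 := hlim.const_mul (Real.exp (2 * (l * R) ^ 2))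
  simp only [integral_const, probReal_univ, smul_eq_mul, mul_one] at h2
  refine ge_of_tendsto' h2 fun m => ?_
  have := integral_exp_sub_le_of_steps hf hl (m + 1) (Nat.succ_pos m)
  push_cast at this
  exact this

theorem HasSubgradients.integrable_exp {f : E → ℝ} {R : ℝ} (hf : HasSubgradients f R) (l : ℝ) :
    Integrable (fun x => Real.exp (l * f x)) (stdGaussian E) := by
  have hc := hf.continuous
  refine ((integrable_exp_mul_norm (|l| * R)).const_mul (Real.exp (|l| * |f 0|))).mono'
    (by fun_prop) (ae_of_all _ fun x => ?_)
  rw [Real.norm_eq_abs, abs_of_pos (Real.exp_pos _), ← Real.exp_add]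
  gcongr
  have h := hf.abs_sub_le x 0
  rw [sub_zero] at h
  have h2 : |f x| ≤ |f 0| + R * ‖x‖ := by
    have := abs_add_le (f x - f 0) (f 0)
    rw [sub_add_cancel] at this
    linarith
  calc l * f x ≤ |l| * |f x| := by rw [← abs_mul]; exact le_abs_self _
    _ ≤ |l| * (|f 0| + R * ‖x‖) := by gcongr
    _ = _ := by ring

theorem HasSubgradients.memLp_two {f : E → ℝ} {R : ℝ} (hf : HasSubgradients f R) :
    MemLp f 2 (stdGaussian E) := by
  have := FiniteDimensional.complete ℝ E
  have h0 : MemLp (fun x : E => R * ‖x‖) 2 (stdGaussian E) :=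
    (MemLp.norm (IsGaussian.memLp_two_id (μ := stdGaussian E))).const_mul R
  have h1 : MemLp (fun x : E => |f 0| + R * ‖x‖) 2 (stdGaussian E) :=
    MemLp.add (f := fun _ : E => |f 0|) (memLp_const _) h0
  refine h1.mono' hf.continuous.aestronglyMeasurable (ae_of_all _ fun x => ?_)
  have h := hf.abs_sub_le x 0
  rw [sub_zero] at h
  have := abs_add_le (f x - f 0) (f 0)
  rw [sub_add_cancel] at this
  rw [Real.norm_eq_abs]
  linarith

theorem HasSubgradients.integrable {f : E → ℝ} {R : ℝ} (hf : HasSubgradients f R) :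
    Integrable f (stdGaussian E) :=
  hf.memLp_two.integrable one_le_two

/-- By Jensen, replacing an independent copy of f by its mean can only lower the exponential moment.
-/
theorem HasSubgradients.integral_exp_centered_le {f : E → ℝ} {R : ℝ} (hf : HasSubgradients f R)
    {l : ℝ} (hl : 0 ≤ l) :
    ∫ x, Real.exp (l * (f x - ∫ y, f y ∂(stdGaussian E))) ∂(stdGaussian E) ≤
      Real.exp (2 * (l * R) ^ 2) := by
  set w := ∫ y, f y ∂(stdGaussian E) with hw
  refine le_trans ?_ (integral_exp_sub_le hf hl)
  have e : ∀ p : E × E, Real.exp (l * (f p.2 - f p.1)) =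
      Real.exp (-l * f p.1) * Real.exp (l * f p.2) := by
    intro p
    rw [← Real.exp_add]
    ring_nf
  simp only [e]
  rw [integral_prod_mul (fun x => Real.exp (-l * f x)) (fun x => Real.exp (l * f x))]
  have e2 : ∀ x, Real.exp (l * (f x - w)) = Real.exp (-l * w) * Real.exp (l * f x) := by
    intro x
    rw [← Real.exp_add]
    ring_nf
  simp only [e2]
  rw [integral_const_mul]
  refine mul_le_mul_of_nonneg_right ?_ (integral_nonneg fun _ => (Real.exp_pos _).le)
  have := convexOn_exp.map_integral_le (μ := stdGaussian E) (f := fun x => -l * f x)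
    Real.continuous_exp.continuousOn isClosed_univ (ae_of_all _ fun _ => mem_univ _)
    (hf.integrable.const_mul _) (hf.integrable_exp _)
  rwa [integral_const_mul] at this

/-- Not an instance of the previous bound, since -f need not have subgradients. The same two-copy
bound is used, with Jensen applied to the other copy. -/
theorem HasSubgradients.integral_exp_neg_centered_le {f : E → ℝ} {R : ℝ}
    (hf : HasSubgradients f R) {l : ℝ} (hl : 0 ≤ l) :
    ∫ x, Real.exp (-(l * (f x - ∫ y, f y ∂(stdGaussian E)))) ∂(stdGaussian E) ≤
      Real.exp (2 * (l * R) ^ 2) := by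
  set w := ∫ y, f y ∂(stdGaussian E) with hw
  refine le_trans ?_ (integral_exp_sub_le hf hl)
  have e : ∀ p : E × E, Real.exp (l * (f p.2 - f p.1)) =
      Real.exp (-l * f p.1) * Real.exp (l * f p.2) := by
    intro p
    rw [← Real.exp_add]
    ring_nf
  simp only [e]
  rw [integral_prod_mul (fun x => Real.exp (-l * f x)) (fun x => Real.exp (l * f x))]
  have e2 : ∀ x, Real.exp (-(l * (f x - w))) = Real.exp (-l * f x) * Real.exp (l * w) := by
    intro x
    rw [← Real.exp_add]
    ring_nf
  simp only [e2]
  rw [integral_mul_const]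
  refine mul_le_mul_of_nonneg_left ?_ (integral_nonneg fun _ => (Real.exp_pos _).le)
  have := convexOn_exp.map_integral_le (μ := stdGaussian E) (f := fun x => l * f x)
    Real.continuous_exp.continuousOn isClosed_univ (ae_of_all _ fun _ => mem_univ _)
    (hf.integrable.const_mul _) (hf.integrable_exp _)
  rwa [integral_const_mul] at this

/-- A dimension free variance bound for Lipschitz convex functions of a Gaussian vector. -/
theorem HasSubgradients.integral_sq_centered_le {f : E → ℝ} {R : ℝ} (hf : HasSubgradients f R)
    (hR : 0 < R) :
    ∫ x, (f x - ∫ y, f y ∂(stdGaussian E)) ^ 2 ∂(stdGaussian E) ≤ 32 * R ^ 2 := by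
  set w := ∫ y, f y ∂(stdGaussian E) with hw
  -- With u = (f - w)/R, the bounds u²/2 ≤ exp u + exp (-u) and exp 2 ≤ 8 give 2 · (8 + 8) = 32.
  have h1 := hf.integral_exp_centered_le (l := 1 / R) (by positivity)
  have h2 := hf.integral_exp_neg_centered_le (l := 1 / R) (by positivity)
  rw [← hw] at h1 h2
  have i1 : Integrable (fun x => Real.exp (1 / R * (f x - w))) (stdGaussian E) := by
    have := (hf.integrable_exp (1 / R)).const_mul (Real.exp (-(1 / R) * w))
    refine this.congr (ae_of_all _ fun x => ?_)
    simp only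
    rw [← Real.exp_add]
    ring_nf
  have i2 : Integrable (fun x => Real.exp (-(1 / R * (f x - w)))) (stdGaussian E) := by
    have := (hf.integrable_exp (-(1 / R))).const_mul (Real.exp ((1 / R) * w))
    refine this.congr (ae_of_all _ fun x => ?_)
    simp only
    rw [← Real.exp_add]
    ring_nf
  have hRR : (1 / R * R) = 1 := by field_simp
  rw [hRR] at h1 h2
  have he : Real.exp (2 * 1 ^ 2) ≤ 8 := by
    have := Real.exp_one_lt_d9
    have e : Real.exp (2 * 1 ^ 2) = Real.exp 1 * Real.exp 1 := by rw [← Real.exp_add]; norm_num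
    rw [e]
    nlinarith [Real.exp_pos 1]
  have hpt : ∀ x, (f x - w) ^ 2 ≤
      2 * R ^ 2 * (Real.exp (1 / R * (f x - w)) + Real.exp (-(1 / R * (f x - w)))) := by
    intro x
    set u := 1 / R * (f x - w) with hu
    have e : f x - w = R * u := by rw [hu]; field_simp
    rw [e, mul_pow]
    have h : u ^ 2 / 2 ≤ Real.exp u + Real.exp (-u) := by
      have hq := Real.quadratic_le_exp_of_nonneg (abs_nonneg u)
      rw [sq_abs] at hq
      have := abs_nonneg u
      have := Real.exp_pos u
      have := Real.exp_pos (-u)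
      rcases abs_cases u with ⟨h, -⟩ | ⟨h, -⟩ <;> rw [h] at hq <;> linarith
    nlinarith [sq_nonneg R]
  calc ∫ x, (f x - w) ^ 2 ∂(stdGaussian E)
      ≤ ∫ x, 2 * R ^ 2 * (Real.exp (1 / R * (f x - w)) + Real.exp (-(1 / R * (f x - w))))
          ∂(stdGaussian E) :=
        integral_mono_of_nonneg (ae_of_all _ fun _ => sq_nonneg _)
          ((i1.add i2).const_mul _) (ae_of_all _ hpt)
    _ = 2 * R ^ 2 * (∫ x, Real.exp (1 / R * (f x - w)) ∂(stdGaussian E) +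
          ∫ x, Real.exp (-(1 / R * (f x - w))) ∂(stdGaussian E)) := by
        rw [integral_const_mul, integral_add i1 i2]
    _ ≤ 2 * R ^ 2 * (8 + 8) := by
        gcongr
        · exact h1.trans he
        · exact h2.trans he
    _ = 32 * R ^ 2 := by ring

/-- Maximal inequality over a finite family of Lipschitz convex functions. -/
theorem integral_le_of_le_sup {ι : Type*} (s : Finset ι) {f : ι → E → ℝ} {R : ℝ}
    (hf : ∀ i ∈ s, HasSubgradients (f i) R) {g : E → ℝ} (hg : Integrable g (stdGaussian E))
    (hgf : ∀ x, ∃ i ∈ s, g x ≤ f i x) {b : ℝ} (hb : ∀ i ∈ s, ∫ x, f i x ∂(stdGaussian E) ≤ b)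
    {l : ℝ} (hl : 0 < l) :
    ∫ x, g x ∂(stdGaussian E) ≤ b + Real.log s.card / l + 2 * l * R ^ 2 := by
  have hcard : 0 < s.card := by
    obtain ⟨i, hi, -⟩ := hgf 0
    exact Finset.card_pos.mpr ⟨i, hi⟩
  have hcard' : (0 : ℝ) < s.card := by exact_mod_cast hcard
  have hi : ∀ i ∈ s, Integrable (fun x => Real.exp (l * (f i x - b))) (stdGaussian E) := by
    intro i hi
    refine (((hf i hi).integrable_exp l).const_mul (Real.exp (-l * b))).congr
      (ae_of_all _ fun x => ?_)
    simp only
    rw [← Real.exp_add]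
    ring_nf
  have hle : ∀ i ∈ s, ∫ x, Real.exp (l * (f i x - b)) ∂(stdGaussian E) ≤
      Real.exp (2 * (l * R) ^ 2) := by
    intro i his
    refine le_trans ?_ ((hf i his).integral_exp_centered_le hl.le)
    refine integral_mono_of_nonneg (ae_of_all _ fun _ => (Real.exp_pos _).le) ?_
      (ae_of_all _ fun x => ?_)
    · refine (((hf i his).integrable_exp l).const_mul
        (Real.exp (-l * ∫ y, f i y ∂(stdGaussian E)))).congr (ae_of_all _ fun x => ?_)
      simp only
      rw [← Real.exp_add]
      ring_nf
    · simp only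
      gcongr
      exact hb i his
  -- Exponentiate, move the exponential inside the integral by Jensen, and bound the maximum by the
  -- sum.
  have hmain : l * (∫ x, g x ∂(stdGaussian E) - b) ≤ Real.log s.card + 2 * (l * R) ^ 2 := by
    rw [← Real.exp_le_exp, Real.exp_add, Real.exp_log hcard']
    have hpt : ∀ x, Real.exp (l * (g x - b)) ≤ ∑ i ∈ s, Real.exp (l * (f i x - b)) := by
      intro x
      obtain ⟨i, his, h⟩ := hgf x
      refine le_trans ?_ (Finset.single_le_sum (f := fun i => Real.exp (l * (f i x - b)))
        (fun _ _ => (Real.exp_pos _).le) his)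
      gcongr
    have hgi : Integrable (fun x => Real.exp (l * (g x - b))) (stdGaussian E) := by
      refine (integrable_finsetSum s hi).mono' ?_ (ae_of_all _ fun x => ?_)
      · exact Real.continuous_exp.comp_aestronglyMeasurable
          ((hg.1.sub aestronglyMeasurable_const).const_mul l)
      · rw [Real.norm_eq_abs, abs_of_pos (Real.exp_pos _)]
        exact hpt x
    have hj := convexOn_exp.map_integral_le (μ := stdGaussian E) (f := fun x => l * (g x - b))
      Real.continuous_exp.continuousOn isClosed_univ (ae_of_all _ fun _ => mem_univ _)
      ((hg.sub (integrable_const b)).const_mul l) hgi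
    rw [integral_const_mul, integral_sub hg (integrable_const b)] at hj
    simp only [integral_const, probReal_univ, smul_eq_mul, one_mul] at hj
    refine hj.trans ?_
    calc ∫ x, Real.exp (l * (g x - b)) ∂(stdGaussian E)
        ≤ ∫ x, ∑ i ∈ s, Real.exp (l * (f i x - b)) ∂(stdGaussian E) :=
          integral_mono hgi (integrable_finsetSum s hi) hpt
      _ = ∑ i ∈ s, ∫ x, Real.exp (l * (f i x - b)) ∂(stdGaussian E) := integral_finsetSum s hi
      _ ≤ ∑ _i ∈ s, Real.exp (2 * (l * R) ^ 2) := Finset.sum_le_sum hle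
      _ = s.card * Real.exp (2 * (l * R) ^ 2) := by rw [Finset.sum_const, nsmul_eq_mul]
  have h3 : ∫ x, g x ∂(stdGaussian E) - b ≤ (Real.log s.card + 2 * (l * R) ^ 2) / l := by
    rw [le_div_iff₀ hl, mul_comm]
    exact hmain
  have e : (Real.log s.card + 2 * (l * R) ^ 2) / l = Real.log s.card / l + 2 * l * R ^ 2 := by
    field_simp
  linarith

end Concentration

/-! ### Gaussian shifts: density, change of measure and linear tails. -/

section CameronMartin

variable {E : Type*} [NormedAddCommGroup E] [InnerProductSpace ℝ E]
variable [FiniteDimensional ℝ E] [MeasurableSpace E] [BorelSpace E]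

/-- The integral factors over an orthonormal basis. It gives the characteristic function of the
exponentially tilted measure, which identifies that measure with the shifted Gaussian. -/
theorem integral_cexp_inner_add_inner_mul_I (v t : E) :
    ∫ x, Complex.exp ((⟪x, v⟫ : ℝ) + (⟪x, t⟫ : ℝ) * Complex.I) ∂(stdGaussian E) =
      Complex.exp (((‖v‖ ^ 2 - ‖t‖ ^ 2) / 2 : ℝ) + (⟪v, t⟫ : ℝ) * Complex.I) := by
  rw [stdGaussian, integral_map (Measurable.aemeasurable (by fun_prop))
    (Measurable.aestronglyMeasurable (by fun_prop))]
  set b := stdOrthonormalBasis ℝ E with hb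
  have h1 : ∀ x : Fin (Module.finrank ℝ E) → ℝ,
      Complex.exp ((⟪∑ i, x i • b i, v⟫ : ℝ) + (⟪∑ i, x i • b i, t⟫ : ℝ) * Complex.I) =
      ∏ i, Complex.exp (((⟪b i, v⟫ : ℝ) + (⟪b i, t⟫ : ℝ) * Complex.I) * (x i : ℝ)) := by
    intro x
    rw [← Complex.exp_sum]
    congr 1
    simp only [sum_inner, real_inner_smul_left, Complex.ofReal_sum, Finset.sum_mul,
      ← Finset.sum_add_distrib]
    refine Finset.sum_congr rfl fun i _ => ?_
    push_cast
    ring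
  have h2 : ∀ z : ℂ, ∫ x : ℝ, Complex.exp (z * (x : ℝ)) ∂(gaussianReal 0 1) =
      Complex.exp (z ^ 2 / 2) := by
    intro z
    have := complexMGF_id_gaussianReal (μ := 0) (v := 1) z
    simpa [complexMGF] using this
  simp only [h1]
  rw [integral_fintype_prod_eq_prod (f := fun i (x : ℝ) =>
    Complex.exp (((⟪b i, v⟫ : ℝ) + (⟪b i, t⟫ : ℝ) * Complex.I) * (x : ℝ)))]
  simp only [h2]
  rw [← Complex.exp_sum]
  congr 1
  have e1 : ∑ i, ⟪b i, v⟫ ^ 2 = ‖v‖ ^ 2 := b.sum_sq_inner_right v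
  have e2 : ∑ i, ⟪b i, t⟫ ^ 2 = ‖t‖ ^ 2 := b.sum_sq_inner_right t
  have e3 : ∑ i, ⟪b i, v⟫ * ⟪b i, t⟫ = ⟪v, t⟫ := by
    rw [← b.sum_inner_mul_inner v t]
    exact Finset.sum_congr rfl fun i _ => by rw [real_inner_comm v]
  rw [← e1, ← e2, ← e3]
  push_cast
  rw [← Finset.sum_sub_distrib, Finset.sum_div, Finset.sum_mul, ← Finset.sum_add_distrib]
  refine Finset.sum_congr rfl fun i _ => ?_
  have := Complex.I_sq
  ring_nf
  rw [this]
  ring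

theorem integrable_exp_inner (v : E) :
    Integrable (fun x : E => Real.exp ⟪x, v⟫) (stdGaussian E) := by
  refine (integrable_exp_mul_norm ‖v‖).mono' (by fun_prop) (ae_of_all _ fun y => ?_)
  rw [Real.norm_eq_abs, abs_of_pos (Real.exp_pos _)]
  exact Real.exp_le_exp.mpr ((real_inner_le_norm y v).trans_eq (mul_comm _ _))

/-- The Cameron-Martin formula. -/
theorem map_const_add_stdGaussian (v : E) :
    (stdGaussian E).map (fun x => v + x) =
      (stdGaussian E).withDensity
        (fun x => ENNReal.ofReal (Real.exp (⟪x, v⟫ - ‖v‖ ^ 2 / 2))) := by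
  have := FiniteDimensional.complete ℝ E
  have hint : Integrable (fun x : E => Real.exp (⟪x, v⟫ - ‖v‖ ^ 2 / 2)) (stdGaussian E) := by
    simp only [Real.exp_sub]
    exact (integrable_exp_inner v).div_const _
  have : IsFiniteMeasure ((stdGaussian E).withDensity
      (fun x => ENNReal.ofReal (Real.exp (⟪x, v⟫ - ‖v‖ ^ 2 / 2)))) :=
    isFiniteMeasure_withDensity_ofReal hint.2
  refine Measure.ext_of_charFun ?_
  ext t
  rw [charFun_map_const_add, charFun_stdGaussian, charFun_apply,
    integral_withDensity_eq_integral_toReal_smul (by fun_prop) (by simp)]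
  have h1 : ∀ x : E, (ENNReal.ofReal (Real.exp (⟪x, v⟫ - ‖v‖ ^ 2 / 2))).toReal •
      Complex.exp ((⟪x, t⟫ : ℝ) * Complex.I) = Complex.exp (-(‖v‖ ^ 2 / 2 : ℝ)) *
        Complex.exp ((⟪x, v⟫ : ℝ) + (⟪x, t⟫ : ℝ) * Complex.I) := by
    intro x
    rw [ENNReal.toReal_ofReal (Real.exp_pos _).le, Complex.real_smul, Complex.ofReal_exp,
      ← Complex.exp_add, ← Complex.exp_add]
    congr 1
    push_cast
    ring
  simp only [h1]
  rw [integral_const_mul, integral_cexp_inner_add_inner_mul_I, ← Complex.exp_add,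
    ← Complex.exp_add]
  congr 1
  push_cast
  ring

/-- Change of measure between Gaussian shifts, in the form given by `2ab ≤ s a² + b² / s`. -/
theorem map_const_add_stdGaussian_real_le (v : E) {A : Set E} (hA : MeasurableSet A) {s : ℝ}
    (hs : 0 < s) :
    ((stdGaussian E).map (fun x => v + x)).real A ≤
      s / 2 * (stdGaussian E).real A + Real.exp (‖v‖ ^ 2) / (2 * s) := by
  have hint : Integrable (fun x : E => Real.exp (⟪x, v⟫ - ‖v‖ ^ 2 / 2)) (stdGaussian E) := by
    simp only [Real.exp_sub]
    exact (integrable_exp_inner v).div_const _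
  have hint2 : Integrable (fun x : E => Real.exp (⟪x, (2 : ℝ) • v⟫ - ‖v‖ ^ 2)) (stdGaussian E) := by
    simp only [Real.exp_sub]
    exact (integrable_exp_inner _).div_const _
  have e1 : ((stdGaussian E).map (fun x => v + x)).real A =
      ∫ x in A, Real.exp (⟪x, v⟫ - ‖v‖ ^ 2 / 2) ∂(stdGaussian E) := by
    rw [map_const_add_stdGaussian, measureReal_def, withDensity_apply _ hA,
      integral_eq_lintegral_of_nonneg_ae (ae_of_all _ fun _ => (Real.exp_pos _).le)
        hint.1.restrict]
  -- Second moment of the likelihood ratio.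
  have e2 : ∫ x, Real.exp (⟪x, (2 : ℝ) • v⟫ - ‖v‖ ^ 2) ∂(stdGaussian E) = Real.exp (‖v‖ ^ 2) := by
    simp only [Real.exp_sub]
    rw [integral_div, integral_exp_inner, ← Real.exp_sub, norm_smul, Real.norm_eq_abs]
    congr 1
    norm_num
    ring
  rw [e1]
  calc ∫ x in A, Real.exp (⟪x, v⟫ - ‖v‖ ^ 2 / 2) ∂(stdGaussian E)
      ≤ ∫ x in A, (s / 2 + 1 / (2 * s) * Real.exp (⟪x, (2 : ℝ) • v⟫ - ‖v‖ ^ 2))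
          ∂(stdGaussian E) := by
        refine integral_mono hint.integrableOn
          ((integrable_const _).add (hint2.const_mul _).integrableOn) fun x => ?_
        have h : Real.exp (⟪x, (2 : ℝ) • v⟫ - ‖v‖ ^ 2) =
            Real.exp (⟪x, v⟫ - ‖v‖ ^ 2 / 2) ^ 2 := by
          rw [← Real.exp_nat_mul, real_inner_smul_right]
          congr 1
          push_cast
          ring
        simp only
        rw [h]
        set u := Real.exp (⟪x, v⟫ - ‖v‖ ^ 2 / 2)
        have : s / 2 + 1 / (2 * s) * u ^ 2 - u = (u - s) ^ 2 / (2 * s) := by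
          field_simp
          ring
        have : 0 ≤ (u - s) ^ 2 / (2 * s) := by positivity
        linarith
    _ = s / 2 * (stdGaussian E).real A +
          1 / (2 * s) * ∫ x in A, Real.exp (⟪x, (2 : ℝ) • v⟫ - ‖v‖ ^ 2) ∂(stdGaussian E) := by
        rw [integral_add (integrable_const _) (hint2.const_mul _).integrableOn,
          integral_const_mul]
        simp [mul_comm]
    _ ≤ s / 2 * (stdGaussian E).real A +
          1 / (2 * s) * ∫ x, Real.exp (⟪x, (2 : ℝ) • v⟫ - ‖v‖ ^ 2) ∂(stdGaussian E) := by
        have := setIntegral_le_integral (s := A) hint2 (ae_of_all _ fun _ => (Real.exp_pos _).le)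
        gcongr
    _ = _ := by
        rw [e2]
        ring

/-- Gaussian tail bound for a linear functional. -/
theorem stdGaussian_real_le_inner_le {u : E} (hu : ‖u‖ ≤ 1) {a : ℝ} (ha : 0 ≤ a) :
    (stdGaussian E).real {x | a ≤ ⟪x, u⟫} ≤ Real.exp (-(a ^ 2 / 2)) := by
  have hint : Integrable (fun x : E => Real.exp (a * ⟪x, u⟫)) (stdGaussian E) := by
    refine (integrable_exp_inner (a • u)).congr (ae_of_all _ fun x => ?_)
    simp [real_inner_smul_right]
  have h := measure_ge_le_exp_mul_mgf a ha hint
  refine h.trans ?_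
  have e : mgf (fun x : E => ⟪x, u⟫) (stdGaussian E) a = Real.exp (‖a • u‖ ^ 2 / 2) := by
    rw [← integral_exp_inner]
    simp [mgf, real_inner_smul_right]
  rw [e, ← Real.exp_add, norm_smul, Real.norm_eq_abs, mul_pow, sq_abs]
  gcongr
  have : a ^ 2 * ‖u‖ ^ 2 ≤ a ^ 2 * 1 ^ 2 := by gcongr
  nlinarith

end CameronMartin

/-! ### Local packing numbers, local entropy and the critical radius. -/

section Packing

variable {n : ℕ} {K : Set (Euc n)} {c ε σ : ℝ}

theorem isSeparated_toNNReal_iff {r : ℝ} (hr : 0 ≤ r) {S : Set (Euc n)} :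
    Metric.IsSeparated (r.toNNReal : ℝ≥0∞) S ↔ ∀ x ∈ S, ∀ y ∈ S, x ≠ y → r < dist x y := by
  have h : ∀ x y : Euc n, ((r.toNNReal : ℝ≥0∞) < edist x y) ↔ r < dist x y := fun x y => by
    rw [edist_dist]
    exact ENNReal.ofReal_lt_ofReal_iff_of_nonneg hr
  constructor
  · intro H x hx y hy hxy
    exact (h x y).mp (H hx hy hxy)
  · intro H x hx y hy hxy
    exact (h x y).mpr (H x hx y hy hxy)

theorem card_le_localPacking (hc : 0 < c) (hε : 0 ≤ ε) {θ : Euc n} (hθ : θ ∈ K)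
    {S : Finset (Euc n)} (hS : ∀ x ∈ S, x ∈ Metric.closedBall θ ε ∩ K)
    (hsep : ∀ x ∈ S, ∀ y ∈ S, x ≠ y → ε / c < dist x y) :
    (S.card : ℕ∞) ≤ localPacking c K ε := by
  rw [← Set.encard_coe_eq_coe_finsetCard]
  refine le_trans ?_ (le_iSup₂_of_le (f := fun θ _ =>
    Metric.packingNumber (ε / c).toNNReal (Metric.closedBall θ ε ∩ K)) θ hθ le_rfl)
  refine Metric.IsSeparated.encard_le_packingNumber (fun x hx => hS x hx) ?_
  rw [isSeparated_toNNReal_iff (by positivity)]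
  exact hsep

theorem card_le_localPacking_toNat (hc : 0 < c) (hε : 0 ≤ ε) {θ : Euc n} (hθ : θ ∈ K)
    {S : Finset (Euc n)} (hS : ∀ x ∈ S, x ∈ Metric.closedBall θ ε ∩ K)
    (hsep : ∀ x ∈ S, ∀ y ∈ S, x ≠ y → ε / c < dist x y) :
    S.card ≤ (localPacking c K ε).toNat := by
  have h := card_le_localPacking hc hε hθ hS hsep
  rw [← ENat.natCast_toNat (localPacking_ne_top hc K hε)] at h
  exact_mod_cast h

theorem exists_packing (hc : 0 < c) (hε : 0 ≤ ε) {m : ℕ} (hm0 : 0 < m)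
    (hm : m ≤ (localPacking c K ε).toNat) :
    ∃ θ ∈ K, ∃ S : Finset (Euc n), S.card = m ∧ (∀ x ∈ S, x ∈ Metric.closedBall θ ε ∩ K) ∧
      ∀ x ∈ S, ∀ y ∈ S, x ≠ y → ε / c < dist x y := by
  -- A strict lower bound can be pulled out of the two suprema without knowing that they are
  -- attained; it yields m points again because `m` is positive.
  have h1 : ((m - 1 : ℕ) : ℕ∞) < localPacking c K ε := by
    rw [← ENat.natCast_toNat (localPacking_ne_top hc K hε)]
    exact_mod_cast (by omega : m - 1 < (localPacking c K ε).toNat)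
  simp only [localPacking, Metric.packingNumber, lt_iSup_iff] at h1
  obtain ⟨θ, hθ, C, hC, hsep, hlt⟩ := h1
  have hle : (m : ℕ∞) ≤ C.encard := by
    have := Order.add_one_le_of_lt hlt
    have e : ((m - 1 : ℕ) : ℕ∞) + 1 = m := by exact_mod_cast (by omega : m - 1 + 1 = m)
    rwa [e] at this
  obtain ⟨t, htC, ht⟩ := Set.exists_subset_encard_eq hle
  have hfin : t.Finite := Set.finite_of_encard_eq_coe ht
  refine ⟨θ, hθ, hfin.toFinset, ?_, fun x hx => hC (htC (by simpa using hx)), ?_⟩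
  · have := hfin.encard_eq_coe_toFinset_card
    rw [ht] at this
    exact_mod_cast this.symm
  · rw [isSeparated_toNNReal_iff (by positivity)] at hsep
    exact fun x hx y hy => hsep x (htC (by simpa using hx)) y (htC (by simpa using hy))

/-- A maximal packing is a cover. -/
theorem exists_cover (hc : 0 < c) (hε : 0 ≤ ε) {θ : Euc n} (hθ : θ ∈ K) :
    ∃ S : Finset (Euc n), S.card ≤ (localPacking c K ε).toNat ∧
      (∀ x ∈ S, x ∈ Metric.closedBall θ ε ∩ K) ∧
      ∀ x ∈ Metric.closedBall θ ε ∩ K, ∃ y ∈ S, dist x y ≤ ε / c := by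
  set A := Metric.closedBall θ ε ∩ K
  have hle : Metric.packingNumber (ε / c).toNNReal A ≤ localPacking c K ε :=
    le_iSup₂_of_le (f := fun θ _ =>
      Metric.packingNumber (ε / c).toNNReal (Metric.closedBall θ ε ∩ K)) θ hθ le_rfl
  have htop : Metric.packingNumber (ε / c).toNNReal A ≠ ⊤ :=
    ne_top_of_le_ne_top (localPacking_ne_top hc K hε) hle
  obtain ⟨C, hCA, hfin, hsep, hcard⟩ := Metric.exists_set_encard_eq_packingNumber htop
  have hcov := Metric.isCover_maximalSeparatedSet htop
  have hcard2 := Metric.encard_maximalSeparatedSet htop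
  have hfin2 : (Metric.maximalSeparatedSet (ε / c).toNNReal A).Finite :=
    Set.encard_ne_top_iff.mp (hcard2 ▸ htop)
  refine ⟨hfin2.toFinset, ?_, fun x hx =>
    Metric.maximalSeparatedSet_subset (by simpa using hx), fun x hx => ?_⟩
  · have h := hfin2.encard_eq_coe_toFinset_card
    rw [hcard2] at h
    rw [h, ← ENat.natCast_toNat (localPacking_ne_top hc K hε)] at hle
    exact_mod_cast hle
  · obtain ⟨y, hy, hxy⟩ := hcov hx
    refine ⟨y, by simpa using hy, ?_⟩
    change edist x y ≤ ENNReal.ofReal (ε / c) at hxy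
    rw [edist_dist] at hxy
    exact (ENNReal.ofReal_le_ofReal_iff (by positivity)).mp hxy

theorem one_le_localPacking_toNat (hc : 0 < c) (hε : 0 ≤ ε) (hne : K.Nonempty) :
    1 ≤ (localPacking c K ε).toNat := by
  obtain ⟨θ, hθ⟩ := hne
  have := card_le_localPacking_toNat (K := K) hc hε hθ (S := {θ}) (by simp [hθ, hε])
    (by simp)
  simpa using this

theorem exp_localEntropy (hc : 0 < c) (hε : 0 ≤ ε) (hne : K.Nonempty) :
    Real.exp (localEntropy c K ε) = ((localPacking c K ε).toNat : ℝ) := by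
  refine Real.exp_log ?_
  exact_mod_cast one_le_localPacking_toNat hc hε hne

/-- Packings of a convex set shrink: the local packing number is antitone in the radius. -/
theorem localPacking_toNat_anti (hconv : Convex ℝ K) (hc : 0 < c) {ε' : ℝ}
    (hε' : 0 < ε') (h : ε' ≤ ε) :
    (localPacking c K ε).toNat ≤ (localPacking c K ε').toNat := by
  have hε : 0 < ε := hε'.trans_le h
  rcases Nat.eq_zero_or_pos (localPacking c K ε).toNat with h0 | h0
  · omega
  obtain ⟨θ, hθ, S, hcard, hS, hsep⟩ := exists_packing hc hε.le h0 le_rfl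
  -- The homothety of ratio t centred at θ maps K into itself by convexity and scales the radius and
  -- the separation alike.
  set t := ε' / ε with ht
  have ht0 : 0 < t := by positivity
  have ht1 : t ≤ 1 := (div_le_one hε).mpr h
  have hinj : Function.Injective (fun x : Euc n => θ + t • (x - θ)) := by
    intro x y hxy
    have := add_left_cancel hxy
    have := smul_right_injective _ ht0.ne' this
    simpa using this
  have hdist : ∀ x y : Euc n, dist (θ + t • (x - θ)) (θ + t • (y - θ)) = t * dist x y := by
    intro x y
    rw [dist_add_left, dist_smul₀, dist_sub_right, Real.norm_eq_abs, abs_of_pos ht0]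
  have := card_le_localPacking_toNat (K := K) (ε := ε') (S := S.map ⟨_, hinj⟩) hc hε'.le hθ ?_ ?_
  · rwa [Finset.card_map, hcard] at this
  · intro x hx
    obtain ⟨y, hy, rfl⟩ := Finset.mem_map.mp hx
    have hy' := hS y hy
    refine ⟨?_, ?_⟩
    · have h2 := hdist y θ
      simp only [sub_self, smul_zero, add_zero] at h2
      simp only [Function.Embedding.coeFn_mk, Metric.mem_closedBall]
      rw [h2]
      have := Metric.mem_closedBall.mp hy'.1
      calc t * dist y θ ≤ t * ε := by gcongr
        _ = ε' := by rw [ht]; field_simp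
    · have := hconv.add_smul_sub_mem hθ hy'.2 ⟨ht0.le, ht1⟩
      simpa using this
  · intro x hx y hy hxy
    obtain ⟨x, hx', rfl⟩ := Finset.mem_map.mp hx
    obtain ⟨y, hy', rfl⟩ := Finset.mem_map.mp hy
    have h1 := hsep x hx' y hy' (fun h => hxy (by rw [h]))
    simp only [Function.Embedding.coeFn_mk]
    rw [hdist]
    calc ε' / c = t * (ε / c) := by rw [ht]; field_simp
      _ < t * dist x y := by gcongr

theorem localEntropy_anti (hconv : Convex ℝ K) (hne : K.Nonempty) (hc : 0 < c) {ε' : ℝ}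
    (hε' : 0 < ε') (h : ε' ≤ ε) : localEntropy c K ε ≤ localEntropy c K ε' := by
  unfold localEntropy
  have h1 := one_le_localPacking_toNat hc (hε'.le.trans h) hne
  have h2 := localPacking_toNat_anti hconv hc hε' h
  gcongr

theorem localEntropy_nonneg : 0 ≤ localEntropy c K ε :=
  Real.log_natCast_nonneg _

/-- A segment of length at least `ε` already contains `17` points at distance `> ε / c`. -/
theorem seventeen_le_localPacking (hconv : Convex ℝ K) (hc : 17 ≤ c) (hε : 0 < ε)
    {p q : Euc n} (hp : p ∈ K) (hq : q ∈ K) (hpq : ε ≤ dist p q) :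
    17 ≤ (localPacking c K ε).toNat := by
  have hc0 : 0 < c := by linarith
  have hd : 0 < dist p q := hε.trans_le hpq
  set t := ε / dist p q with ht
  have ht0 : 0 < t := by positivity
  have ht1 : t ≤ 1 := (div_le_one hd).mpr hpq
  have htd : t * dist p q = ε := by rw [ht]; field_simp
  let g : ℕ → Euc n := fun j => p + (t * (j / 16)) • (q - p)
  have hdist : ∀ i j : ℕ, dist (g i) (g j) = ε / 16 * |(i : ℝ) - j| := by
    intro i j
    simp only [g]
    rw [dist_add_left, dist_eq_norm, ← sub_smul, norm_smul, ← dist_eq_norm q p, dist_comm q p,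
      ← htd, Real.norm_eq_abs]
    have : t * ((i : ℝ) / 16) - t * (j / 16) = t / 16 * (i - j) := by ring
    rw [this, abs_mul, abs_of_pos (by positivity : 0 < t / 16)]
    ring
  have hinj : Function.Injective g := by
    intro i j hij
    have h := hdist i j
    rw [hij, dist_self] at h
    have h2 : |(i : ℝ) - j| = 0 := by
      rcases mul_eq_zero.mp h.symm with h | h
      · linarith
      · exact h
    have := sub_eq_zero.mp (abs_eq_zero.mp h2)
    exact_mod_cast this
  have := card_le_localPacking_toNat (K := K) (ε := ε) (S := (Finset.range 17).map ⟨g, hinj⟩)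
    hc0 hε.le hp ?_ ?_
  · simpa using this
  · intro x hx
    obtain ⟨j, hj, rfl⟩ := Finset.mem_map.mp hx
    have hj' : (j : ℝ) ≤ 16 := by
      have := Finset.mem_range.mp hj
      exact_mod_cast (by omega : j ≤ 16)
    refine ⟨?_, ?_⟩
    · have h2 := hdist j 0
      have e : g 0 = p := by simp [g]
      rw [e] at h2
      simp only [Function.Embedding.coeFn_mk, Metric.mem_closedBall]
      rw [h2]
      simp only [Nat.cast_zero, sub_zero, Nat.abs_cast]
      calc ε / 16 * j ≤ ε / 16 * 16 := by gcongr
        _ = ε := by ring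
    · refine hconv.add_smul_sub_mem hp hq ⟨by positivity, ?_⟩
      have : (j : ℝ) / 16 ≤ 1 := by linarith
      exact mul_le_one₀ ht1 (by positivity) this
  · intro x hx y hy hxy
    obtain ⟨i, hi, rfl⟩ := Finset.mem_map.mp hx
    obtain ⟨j, hj, rfl⟩ := Finset.mem_map.mp hy
    simp only [Function.Embedding.coeFn_mk]
    rw [hdist]
    have hij : i ≠ j := fun h => hxy (by rw [h])
    have h1 : (1 : ℝ) ≤ |(i : ℝ) - j| := by
      have : (1 : ℤ) ≤ |(i : ℤ) - j| := Int.one_le_abs (by omega)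
      exact_mod_cast this
    calc ε / c ≤ ε / 17 := by gcongr
      _ < ε / 16 * 1 := by linarith
      _ ≤ _ := by gcongr

/-- The entropy decreases in ε while ε²/σ² grows. Without boundedness the real `sSup` would take the
default value 0. -/
theorem epsStar_bddAbove (hconv : Convex ℝ K) (hne : K.Nonempty) (hc : 0 < c) (hσ : 0 < σ) :
    BddAbove {ε : ℝ | 0 ≤ ε ∧ ε ^ 2 / σ ^ 2 ≤ localEntropy c K ε} := by
  refine ⟨1 + σ ^ 2 * localEntropy c K 1, fun ε ⟨h0, h⟩ => ?_⟩
  have hl : 0 ≤ localEntropy c K 1 := localEntropy_nonneg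
  have hσl : 0 ≤ σ ^ 2 * localEntropy c K 1 := by positivity
  rcases le_total ε 1 with h1 | h1
  · linarith
  · have h2 := h.trans (localEntropy_anti hconv hne hc one_pos h1)
    rw [div_le_iff₀ (by positivity)] at h2
    nlinarith

theorem epsStar_nonneg : 0 ≤ epsStar c σ K :=
  Real.sSup_nonneg fun _ h => h.1

theorem le_epsStar (hconv : Convex ℝ K) (hne : K.Nonempty) (hc : 0 < c) (hσ : 0 < σ)
    (hε : 0 ≤ ε) (h : ε ^ 2 / σ ^ 2 ≤ localEntropy c K ε) : ε ≤ epsStar c σ K :=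
  le_csSup (epsStar_bddAbove hconv hne hc hσ) ⟨hε, h⟩

/-- Above the critical radius the local entropy is bounded by `(ε* / σ)²`. -/
theorem localEntropy_le_of_epsStar_lt (hconv : Convex ℝ K) (hne : K.Nonempty) (hc : 0 < c)
    (hσ : 0 < σ) (h : epsStar c σ K < ε) :
    localEntropy c K ε ≤ epsStar c σ K ^ 2 / σ ^ 2 := by
  have h0 : 0 ≤ epsStar c σ K := epsStar_nonneg
  set e := epsStar c σ K with he
  -- A radius u just above ε* violates the defining inequality, and the entropy at ε is at most that
  -- at u. Then u decreases to ε*.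
  have key : ∀ u ∈ Ioo e ε, localEntropy c K ε ≤ u ^ 2 / σ ^ 2 := by
    intro u hu
    have hu0 : 0 < u := h0.trans_lt hu.1
    refine (localEntropy_anti hconv hne hc hu0 hu.2.le).trans ?_
    by_contra hlt
    exact absurd (le_epsStar hconv hne hc hσ hu0.le (not_le.mp hlt).le) (not_le.mpr hu.1)
  have hcont : Filter.Tendsto (fun u : ℝ => u ^ 2 / σ ^ 2) (nhdsWithin e (Ioi e))
      (nhds (e ^ 2 / σ ^ 2)) :=
    ((by fun_prop : Continuous fun u : ℝ => u ^ 2 / σ ^ 2).tendsto e).mono_left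
      nhdsWithin_le_nhds
  refine ge_of_tendsto hcont ?_
  filter_upwards [Ioo_mem_nhdsGT h] with u hu using key u hu

/-- With 17 points on a segment the entropy is at least 1, enough for every radius up to σ to
satisfy the inequality defining ε*. -/
theorem one_le_log_seventeen : (1 : ℝ) ≤ Real.log 17 := by
  rw [Real.le_log_iff_exp_le (by norm_num)]
  have := Real.exp_one_lt_d9
  linarith

/-- The critical radius is at least the minimum of the noise level and the diameter. -/
theorem min_dist_le_epsStar (hconv : Convex ℝ K) (hc : 17 ≤ c) (hσ : 0 < σ)
    {p q : Euc n} (hp : p ∈ K) (hq : q ∈ K) : min (dist p q) σ ≤ epsStar c σ K := by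
  have hc0 : 0 < c := by linarith
  rcases (dist_nonneg (x := p) (y := q)).eq_or_lt with h | h
  · rw [← h, min_eq_left hσ.le]
    exact epsStar_nonneg
  · have hm : 0 < min (dist p q) σ := lt_min h hσ
    refine le_epsStar hconv ⟨p, hp⟩ hc0 hσ hm.le ?_
    have h17 := seventeen_le_localPacking hconv hc hm hp hq (min_le_left _ _)
    have h1 : min (dist p q) σ ^ 2 / σ ^ 2 ≤ 1 := by
      rw [div_le_one (by positivity)]
      gcongr
      exact min_le_right _ _
    refine h1.trans (one_le_log_seventeen.trans ?_)
    unfold localEntropy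
    gcongr
    exact_mod_cast h17

/-- The degenerate regime: below the noise level, ε* dominates the diameter of K. -/
theorem dist_le_epsStar_of_lt (hconv : Convex ℝ K) (hc : 17 ≤ c) (hσ : 0 < σ)
    (h : epsStar c σ K < σ) {p q : Euc n} (hp : p ∈ K) (hq : q ∈ K) :
    dist p q ≤ epsStar c σ K := by
  have h1 := min_dist_le_epsStar hconv hc hσ hp hq
  rcases min_le_iff.mp h1 with h2 | h2
  · exact h2
  · linarith

/-- A finite separated subset of `K` has few points in a ball: count along the scales `r cᵏ`. -/
theorem card_le_of_separated (hconv : Convex ℝ K) (hne : K.Nonempty) (hc : 17 ≤ c) (hσ : 0 < σ)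
    {r : ℝ} (hr : 0 < r) (hrε : epsStar c σ K < r) (k : ℕ) {θ : Euc n} (hθ : θ ∈ K)
    {S : Finset (Euc n)} (hS : ∀ x ∈ S, x ∈ Metric.closedBall θ (r * c ^ k) ∩ K)
    (hsep : ∀ x ∈ S, ∀ y ∈ S, x ≠ y → 2 * r < dist x y) :
    (S.card : ℝ) ≤ Real.exp (epsStar c σ K ^ 2 / σ ^ 2) ^ k := by
  classical
  have hc0 : 0 < c := by linarith
  induction k generalizing θ S with
  | zero =>
    rw [pow_zero]
    have : S.card ≤ 1 := by
      refine Finset.card_le_one.mpr fun x hx y hy => ?_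
      by_contra hxy
      have h1 := hsep x hx y hy hxy
      have h2 := Metric.mem_closedBall.mp (hS x hx).1
      have h3 := Metric.mem_closedBall.mp (hS y hy).1
      have h4 := dist_triangle_right x y θ
      rw [pow_zero, mul_one] at h2 h3
      linarith
    exact_mod_cast this
  | succ k ih =>
    have hpos : 0 < r * c ^ (k + 1) := by positivity
    have hbig : epsStar c σ K < r * c ^ (k + 1) := by
      have : (1 : ℝ) ≤ c ^ (k + 1) := one_le_pow₀ (by linarith)
      nlinarith
    obtain ⟨N, hNcard, hN, hcov⟩ := exists_cover (K := K) (ε := r * c ^ (k + 1)) hc0 hpos.le hθ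
    -- Every scale used exceeds ε*, so shrinking the radius by c costs a factor of at most
    -- exp(ε*²/σ²) pieces.
    have hent : ((localPacking c K (r * c ^ (k + 1))).toNat : ℝ) ≤
        Real.exp (epsStar c σ K ^ 2 / σ ^ 2) := by
      rw [← exp_localEntropy hc0 hpos.le hne]
      exact Real.exp_le_exp.mpr (localEntropy_le_of_epsStar_lt hconv hne hc0 hσ hbig)
    have hdiv : r * c ^ (k + 1) / c = r * c ^ k := by
      rw [pow_succ, ← mul_assoc, mul_div_cancel_right₀ _ hc0.ne']
    have hsub : S ⊆ N.biUnion fun y => S.filter fun x => dist x y ≤ r * c ^ k := by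
      intro x hx
      obtain ⟨y, hy, hxy⟩ := hcov x (hS x hx)
      rw [hdiv] at hxy
      exact Finset.mem_biUnion.mpr ⟨y, hy, Finset.mem_filter.mpr ⟨hx, hxy⟩⟩
    have hone : ∀ y ∈ N, ((S.filter fun x => dist x y ≤ r * c ^ k).card : ℝ) ≤
        Real.exp (epsStar c σ K ^ 2 / σ ^ 2) ^ k := by
      intro y hy
      refine ih (hN y hy).2 (fun x hx => ?_) fun x hx z hz => ?_
      · have hx := Finset.mem_filter.mp hx
        exact ⟨hx.2, (hS x hx.1).2⟩
      · exact hsep x (Finset.mem_filter.mp hx).1 z (Finset.mem_filter.mp hz).1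
    calc (S.card : ℝ)
        ≤ ((N.biUnion fun y => S.filter fun x => dist x y ≤ r * c ^ k).card : ℝ) := by
          exact_mod_cast Finset.card_le_card hsub
      _ ≤ ∑ y ∈ N, ((S.filter fun x => dist x y ≤ r * c ^ k).card : ℝ) := by
          exact_mod_cast Finset.card_biUnion_le
      _ ≤ ∑ _y ∈ N, Real.exp (epsStar c σ K ^ 2 / σ ^ 2) ^ k := Finset.sum_le_sum hone
      _ = N.card * Real.exp (epsStar c σ K ^ 2 / σ ^ 2) ^ k := by
          rw [Finset.sum_const, nsmul_eq_mul]
      _ ≤ Real.exp (epsStar c σ K ^ 2 / σ ^ 2) * Real.exp (epsStar c σ K ^ 2 / σ ^ 2) ^ k := by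
          gcongr
          exact le_trans (by exact_mod_cast hNcard) hent
      _ = _ := (pow_succ' _ _).symm

end Packing

/-! ### Lower bound on the minimax risk. -/

section LowerBound

variable {n : ℕ} {K : Set (Euc n)} {c σ : ℝ}

instance isProbabilityMeasure_obsLaw (σ : ℝ) (μ : Euc n) : IsProbabilityMeasure (obsLaw σ μ) :=
  Measure.isProbabilityMeasure_map (by fun_prop)

theorem obsLaw_real_le (hσ : 0 < σ) (θ μ : Euc n) {A : Set (Euc n)} (hA : MeasurableSet A)
    {s : ℝ} (hs : 0 < s) :
    (obsLaw σ μ).real A ≤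
      s / 2 * (obsLaw σ θ).real A + Real.exp (dist μ θ ^ 2 / σ ^ 2) / (2 * s) := by
  set v : Euc n := σ⁻¹ • (μ - θ) with hv
  have hm : ∀ ν : Euc n, Measurable fun z : Euc n => ν + σ • z := fun ν => by fun_prop
  have hA' : MeasurableSet ((fun z : Euc n => θ + σ • z) ⁻¹' A) := hm θ hA
  have h := map_const_add_stdGaussian_real_le v hA' hs
  have e1 : ((stdGaussian (Euc n)).map fun x => v + x).real ((fun z => θ + σ • z) ⁻¹' A) =
      (obsLaw σ μ).real A := by
    rw [map_measureReal_apply (by fun_prop) hA', obsLaw, map_measureReal_apply (hm μ) hA]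
    congr 1
    ext z
    simp only [mem_preimage]
    rw [hv, smul_add, smul_smul, mul_inv_cancel₀ hσ.ne', one_smul]
    congr! 1
    abel
  have e2 : (stdGaussian (Euc n)).real ((fun z => θ + σ • z) ⁻¹' A) = (obsLaw σ θ).real A := by
    rw [obsLaw, map_measureReal_apply (hm θ) hA]
  have e3 : ‖v‖ ^ 2 = dist μ θ ^ 2 / σ ^ 2 := by
    rw [hv, norm_smul, mul_pow, dist_eq_norm, norm_inv, Real.norm_eq_abs, inv_pow, sq_abs]
    ring
  rwa [e1, e2, e3] at h

/-- A large packing in a small ball forces a large risk. -/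
theorem le_worstRisk_of_packing (hσ : 0 < σ) {ρ s : ℝ} (hs : 0 < s) (θ : Euc n)
    {S : Finset (Euc n)} (hSK : ∀ x ∈ S, x ∈ K) (hSρ : ∀ x ∈ S, dist x θ ≤ ρ)
    (hsep : ∀ x ∈ S, ∀ y ∈ S, x ≠ y → 2 * s < dist x y)
    (hcard : 4 * Real.exp (ρ ^ 2 / σ ^ 2) ≤ S.card) {δ : Euc n → Euc n} (hδ : Measurable δ) :
    ENNReal.ofReal (s ^ 2 / 2) ≤ worstRisk σ K δ := by
  let A : Euc n → Set (Euc n) := fun x => {y | dist (δ y) x ≤ s}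
  have hA : ∀ x, MeasurableSet (A x) := fun x =>
    measurableSet_le (hδ.dist measurable_const) measurable_const
  have hM : (0 : ℝ) < S.card := lt_of_lt_of_le (by positivity) hcard
  have hdisj : Set.PairwiseDisjoint (S : Set (Euc n)) A := by
    intro x hx y hy hxy
    refine Set.disjoint_left.mpr fun z hzx hzy => ?_
    have h1 := hsep x hx y hy hxy
    have h2 : dist (δ z) x ≤ s := hzx
    have h3 : dist (δ z) y ≤ s := hzy
    have := dist_triangle_left x y (δ z)
    linarith
  have hsum : ∑ x ∈ S, (obsLaw σ θ).real (A x) ≤ 1 := by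
    rw [← measureReal_biUnion_finset hdisj fun x _ => hA x]
    exact measureReal_le_one
  -- The events A x are disjoint, so under the reference law at θ their probabilities sum to at most
  -- 1. The change of measure with weight `S.card / 2` bounds the sum of the probabilities under
  -- their own laws by M/4 + exp(ρ²/σ²) ≤ M/2, where M = `S.card`.
  obtain ⟨x, hx, hxA⟩ : ∃ x ∈ S, (obsLaw σ x).real (A x) ≤ 1 / 2 := by
    by_contra! hcon
    have h1 : (S.card : ℝ) * (1 / 2) < ∑ x ∈ S, (obsLaw σ x).real (A x) := by
      rw [← nsmul_eq_mul, ← Finset.sum_const]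
      refine Finset.sum_lt_sum_of_nonempty ?_ hcon
      exact Finset.card_pos.mp (by exact_mod_cast hM)
    have h2 : ∑ x ∈ S, (obsLaw σ x).real (A x) ≤
        ∑ x ∈ S, ((S.card / 2 : ℝ) / 2 * (obsLaw σ θ).real (A x) +
          Real.exp (ρ ^ 2 / σ ^ 2) / (2 * (S.card / 2 : ℝ))) := by
      refine Finset.sum_le_sum fun x hx => ?_
      refine (obsLaw_real_le hσ θ x (hA x) (half_pos hM)).trans ?_
      have := hSρ x hx
      gcongr
    rw [Finset.sum_add_distrib, ← Finset.mul_sum, Finset.sum_const, nsmul_eq_mul] at h2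
    have h3 : (S.card : ℝ) * (Real.exp (ρ ^ 2 / σ ^ 2) / (2 * (S.card / 2 : ℝ))) =
        Real.exp (ρ ^ 2 / σ ^ 2) := by field_simp
    rw [h3] at h2
    have h4 : (S.card / 2 : ℝ) / 2 * ∑ x ∈ S, (obsLaw σ θ).real (A x) ≤
        (S.card / 2 : ℝ) / 2 * 1 := by gcongr
    linarith
  have hcompl : 1 / 2 ≤ (obsLaw σ x).real (A x)ᶜ := by
    rw [probReal_compl_eq_one_sub (hA x)]
    linarith
  calc ENNReal.ofReal (s ^ 2 / 2)
      ≤ ENNReal.ofReal (s ^ 2) * (obsLaw σ x) (A x)ᶜ := by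
        rw [← ofReal_measureReal, ← ENNReal.ofReal_mul (by positivity)]
        refine ENNReal.ofReal_le_ofReal ?_
        nlinarith [sq_nonneg s]
    _ = ∫⁻ _y in (A x)ᶜ, ENNReal.ofReal (s ^ 2) ∂(obsLaw σ x) := by
        rw [setLIntegral_const]
    _ ≤ ∫⁻ y in (A x)ᶜ, ‖δ y - x‖ₑ ^ 2 ∂(obsLaw σ x) := by
        refine setLIntegral_mono' (hA x).compl fun y hy => ?_
        have hy' : s < dist (δ y) x := not_le.mp hy
        rw [← ofReal_norm, ← ENNReal.ofReal_pow (norm_nonneg _), ← dist_eq_norm]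
        gcongr
    _ ≤ ∫⁻ y, ‖δ y - x‖ₑ ^ 2 ∂(obsLaw σ x) := setLIntegral_le_lintegral _ _
    _ ≤ worstRisk σ K δ :=
        le_iSup₂_of_le (f := fun μ _ => ∫⁻ y, ‖δ y - μ‖ₑ ^ 2 ∂(obsLaw σ μ)) x (hSK x hx) le_rfl

/-- The minimax risk is at least of the order of the squared critical radius. -/
theorem ofReal_epsStar_sq_le_minimaxRisk (hconv : Convex ℝ K) (hne : K.Nonempty) (hc : 17 ≤ c)
    (hσ : 0 < σ) :
    ENNReal.ofReal (epsStar c σ K ^ 2 / (32 * c ^ 4)) ≤ minimaxRisk σ K := by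
  have hc0 : 0 < c := by linarith
  refine le_iInf₂ fun δ hδ => ?_
  rcases (epsStar_nonneg (c := c) (σ := σ) (K := K)).eq_or_lt with h0 | h0
  · simp [← h0]
  obtain ⟨ε, ⟨hε0, hε⟩, hlt⟩ := exists_lt_of_lt_csSup
    (s := {ε : ℝ | 0 ≤ ε ∧ ε ^ 2 / σ ^ 2 ≤ localEntropy c K ε}) (b := epsStar c σ K / 2)
    ⟨0, le_rfl, by simpa using localEntropy_nonneg⟩ (half_lt_self h0)
  have hεpos : 0 < ε := (half_pos h0).trans hlt
  have hε' : 0 < ε / c := by positivity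
  have hexp : Real.exp (ε ^ 2 / σ ^ 2) ≤ ((localPacking c K ε).toNat : ℝ) := by
    rw [← exp_localEntropy hc0 hε0 hne]
    exact Real.exp_le_exp.mpr hε
  -- Two points at distance more than ε/c exist, so at radius ε/c there are at least 17 packing
  -- points. Passing from ε to ε/c also shrinks the exponent enough to gain the factor 4 required by
  -- `le_worstRisk_of_packing`.
  have htwo : 2 ≤ (localPacking c K ε).toNat := by
    have h1 : (1 : ℝ) < Real.exp (ε ^ 2 / σ ^ 2) := Real.one_lt_exp_iff.mpr (by positivity)
    exact_mod_cast h1.trans_le hexp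
  obtain ⟨θ₀, -, T, hTcard, hT, hTsep⟩ := exists_packing hc0 hε0 two_pos htwo
  obtain ⟨p, hp, q, hq, hpq⟩ := Finset.one_lt_card.mp (by omega : 1 < T.card)
  have hdist := hTsep p hp q hq hpq
  set M := (localPacking c K (ε / c)).toNat with hM
  have h17 : 17 ≤ M :=
    seventeen_le_localPacking hconv hc hε' (hT p hp).2 (hT q hq).2 hdist.le
  have hanti : (localPacking c K ε).toNat ≤ M :=
    localPacking_toNat_anti hconv hc0 hε' (div_le_self hε0 (by linarith))
  obtain ⟨θ, hθ, S, hScard, hS, hSsep⟩ := exists_packing (K := K) hc0 hε'.le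
    (by omega : 0 < M) le_rfl
  have hcard : 4 * Real.exp ((ε / c) ^ 2 / σ ^ 2) ≤ S.card := by
    have h1 : Real.exp (ε ^ 2 / σ ^ 2) ≤ (M : ℝ) := hexp.trans (by exact_mod_cast hanti)
    have h2 : (16 : ℝ) ≤ M := by exact_mod_cast (by omega : 16 ≤ M)
    rw [hScard]
    -- After squaring, one factor M is at least 16 and the other at least exp(ε²/σ²), which
    -- dominates exp(2(ε/c)²/σ²).
    refine le_of_sq_le_sq ?_ (by positivity)
    have h3 : Real.exp ((ε / c) ^ 2 / σ ^ 2) ^ 2 ≤ Real.exp (ε ^ 2 / σ ^ 2) := by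
      rw [← Real.exp_nat_mul]
      refine Real.exp_le_exp.mpr ?_
      have : 2 * (ε / c) ^ 2 ≤ ε ^ 2 := by
        rw [div_pow, mul_div_assoc', div_le_iff₀ (by positivity)]
        have : (2 : ℝ) ≤ c ^ 2 := by nlinarith
        nlinarith [sq_nonneg ε]
      rw [mul_div_assoc']
      gcongr
      exact_mod_cast this
    rw [mul_pow]
    nlinarith [Real.exp_pos (ε ^ 2 / σ ^ 2)]
  refine le_trans (ENNReal.ofReal_le_ofReal ?_) (le_worstRisk_of_packing (K := K) hσ
    (s := ε / c / (2 * c)) (by positivity) θ (fun x hx => (hS x hx).2)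
    (fun x hx => Metric.mem_closedBall.mp (hS x hx).1) (fun x hx y hy hxy => ?_) hcard hδ)
  · have e : (ε / c / (2 * c)) ^ 2 / 2 = (2 * ε) ^ 2 / (32 * c ^ 4) := by
      field_simp
      ring
    rw [e]
    gcongr
    linarith
  · have := hSsep x hx y hy hxy
    have e : 2 * (ε / c / (2 * c)) = ε / c / c := by field_simp
    rwa [e]

end LowerBound

/-! ### Upper bound on the minimax risk by a sieve estimator. -/

section UpperBound

variable {n : ℕ} {K : Set (Euc n)} {c σ : ℝ}

theorem exists_maximal_isSeparated (r : ℝ≥0∞) (K : Set (Euc n)) :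
    ∃ S, Maximal (fun N => N ⊆ K ∧ Metric.IsSeparated r N) S := by
  refine zorn_subset {N | N ⊆ K ∧ Metric.IsSeparated r N} fun C hC hchain => ?_
  refine ⟨⋃₀ C, ⟨sUnion_subset fun s hs => (hC hs).1, ?_⟩, fun s hs => subset_sUnion_of_mem hs⟩
  exact (pairwise_sUnion hchain.directedOn).mpr fun s hs => (hC hs).2

/-- A nonempty locally finite set admits a measurable nearest point selection. -/
theorem exists_measurable_nearest {S : Set (Euc n)} (hne : S.Nonempty)
    (hfin : ∀ R, (S ∩ Metric.closedBall 0 R).Finite) :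
    ∃ δ : Euc n → Euc n, Measurable δ ∧ ∀ y, δ y ∈ S ∧ ∀ x ∈ S, ‖y - δ y‖ ≤ ‖y - x‖ := by
  classical
  have hcount : S.Countable := by
    have : S = ⋃ k : ℕ, S ∩ Metric.closedBall 0 (k : ℝ) := by
      rw [← inter_iUnion, Metric.iUnion_closedBall_nat, inter_univ]
    rw [this]
    exact countable_iUnion fun k => (hfin k).countable
  obtain ⟨s, hs⟩ := hcount.exists_eq_range hne
  have hmem : ∀ i, s i ∈ S := fun i => hs ▸ mem_range_self i
  have hex : ∀ y, ∃ i, ∀ j, ‖y - s i‖ ≤ ‖y - s j‖ := by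
    intro y
    -- Points of norm above R are farther from y than `s 0`, so the minimum is over a finite set.
    -- Taking the first minimizing index makes the selection measurable.
    set R := ‖y‖ + ‖y - s 0‖ with hR
    have h0 : s 0 ∈ S ∩ Metric.closedBall 0 R := by
      refine ⟨hmem 0, mem_closedBall_zero_iff.mpr ?_⟩
      have := norm_sub_le y (y - s 0)
      rwa [sub_sub_cancel] at this
    obtain ⟨x, hx, hmin⟩ := Set.exists_min_image _ (fun x => ‖y - x‖) (hfin R) ⟨_, h0⟩
    obtain ⟨i, rfl⟩ : ∃ i, s i = x := by
      have := hx.1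
      rw [hs] at this
      exact this
    refine ⟨i, fun j => ?_⟩
    by_cases hj : s j ∈ Metric.closedBall 0 R
    · exact hmin _ ⟨hmem j, hj⟩
    · have h1 : R < ‖s j‖ := by
        rw [mem_closedBall_zero_iff] at hj
        exact not_le.mp hj
      have h2 := hmin _ h0
      have h3 := norm_sub_le y (y - s j)
      rw [sub_sub_cancel] at h3
      linarith
  refine ⟨fun y => s (Nat.find (hex y)), ?_, fun y => ⟨hmem _, fun x hx => ?_⟩⟩
  · refine (measurable_from_nat (f := s)).comp (measurable_find hex fun k => ?_)
    rw [ofPred_forall]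
    exact MeasurableSet.iInter fun j => measurableSet_le (by fun_prop) (by fun_prop)
  · rw [hs] at hx
    obtain ⟨j, rfl⟩ := hx
    exact Nat.find_spec (hex y) j

/-- A far point `x` beats the reference point `p`, close to the truth, with small probability. -/
theorem obsLaw_real_closer_le (hσ : 0 < σ) {μ p x : Euc n} {r D : ℝ} (hr : 0 < r)
    (hp : ‖μ - p‖ ≤ 2 * r) (hD : 17 * r ≤ D) (hx : D ≤ ‖x - p‖) :
    (obsLaw σ μ).real {y | ‖y - x‖ ≤ ‖y - p‖} ≤ Real.exp (-(D ^ 2 / (32 * σ ^ 2))) := by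
  have hD0 : 0 < D := by linarith
  have hx0 : 0 < ‖x - p‖ := hD0.trans_le hx
  set u : Euc n := ‖x - p‖⁻¹ • (x - p) with hu
  have hu1 : ‖u‖ ≤ 1 := by
    rw [hu, norm_smul, norm_inv, norm_norm, inv_mul_cancel₀ hx0.ne']
  have hsub : (fun z : Euc n => μ + σ • z) ⁻¹' {y | ‖y - x‖ ≤ ‖y - p‖} ⊆
      {z | D / (4 * σ) ≤ ⟪z, u⟫} := by
    intro z hz
    have hz' : ‖μ + σ • z - x‖ ≤ ‖μ + σ • z - p‖ := hz
    have e1 : μ + σ • z - x = (μ + σ • z - p) - (x - p) := by abel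
    have h1 : ‖μ + σ • z - x‖ ^ 2 ≤ ‖μ + σ • z - p‖ ^ 2 := by gcongr
    rw [e1, norm_sub_sq_real] at h1
    have e2 : ⟪μ + σ • z - p, x - p⟫ = ⟪μ - p, x - p⟫ + σ * ⟪z, x - p⟫ := by
      rw [← real_inner_smul_left, ← inner_add_left]
      congr 1
      abel
    have h2 : ⟪μ - p, x - p⟫ ≤ 2 * r * ‖x - p‖ :=
      (real_inner_le_norm _ _).trans (by gcongr)
    have e3 : ⟪z, x - p⟫ = ‖x - p‖ * ⟪z, u⟫ := by
      rw [hu, real_inner_smul_right]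
      field_simp
    rw [e2, e3] at h1
    -- Hence 2σ⟪z, u⟫ ≥ D - 4r ≥ D/2, because D ≥ 17r.
    have h3 : ‖x - p‖ * ‖x - p‖ ≤ ‖x - p‖ * (4 * r + 2 * σ * ⟪z, u⟫) := by nlinarith
    have h4 := le_of_mul_le_mul_left h3 hx0
    change D / (4 * σ) ≤ ⟪z, u⟫
    rw [div_le_iff₀ (by positivity)]
    nlinarith
  have hmeas : MeasurableSet {y : Euc n | ‖y - x‖ ≤ ‖y - p‖} :=
    measurableSet_le (by fun_prop) (by fun_prop)
  rw [obsLaw, map_measureReal_apply (by fun_prop) hmeas]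
  refine (measureReal_mono hsub).trans
    ((stdGaussian_real_le_inner_le hu1 (by positivity)).trans_eq ?_)
  congr 2
  field_simp
  norm_num

/-- Union bound over one shell: with x = c^(2k) ≥ k + 1, the Gaussian exponent 8qx absorbs the
entropy (k + 1)q and leaves at least x, while exp(-x) ≤ 2/x². -/
theorem exp_shell_le {c q : ℝ} (hc : 17 ≤ c) (hq : 1 ≤ q) (k : ℕ) :
    Real.exp q ^ (k + 1) * Real.exp (-(8 * q * c ^ (2 * k))) ≤ 2 / c ^ (4 * k) := by
  have hx : (k : ℝ) + 1 ≤ c ^ (2 * k) := by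
    have h1 : (1 : ℝ) + k * 1 ≤ (1 + 1) ^ k := one_add_mul_le_pow (by norm_num) k
    have h2 : (1 + 1 : ℝ) ^ k ≤ (c ^ 2) ^ k := by
      gcongr
      nlinarith
    rw [← pow_mul] at h2
    linarith
  set x := c ^ (2 * k) with hxdef
  have hx0 : 0 < x := by positivity
  have e : c ^ (4 * k) = x ^ 2 := by rw [hxdef, ← pow_mul]; ring_nf
  rw [e, ← Real.exp_nat_mul, ← Real.exp_add]
  have h1 : ((k + 1 : ℕ) : ℝ) * q + -(8 * q * x) ≤ -x := by
    push_cast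
    nlinarith
  refine (Real.exp_le_exp.mpr h1).trans ?_
  rw [Real.exp_neg, inv_eq_one_div, div_le_div_iff₀ (Real.exp_pos _) (by positivity)]
  have := Real.quadratic_le_exp_of_nonneg hx0.le
  nlinarith

/-- The nearest point estimator over a maximal separated subset of `K` (a sieve). -/
theorem minimaxRisk_le (hconv : Convex ℝ K) (hne : K.Nonempty) (hc : 17 ≤ c)
    (hσ : 0 < σ) (hσε : σ ≤ epsStar c σ K) :
    minimaxRisk σ K ≤ ENNReal.ofReal (12 * (16 * epsStar c σ K) ^ 2 * c ^ 2) := by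
  classical
  have hc0 : 0 < c := by linarith
  set e := epsStar c σ K with he
  have he0 : 0 < e := hσ.trans_le hσε
  -- The factor 16 makes the tail exponent D²/(32σ²) equal to 8q c^(2(j+1)) on the shell of inner
  -- radius D = r c^(j+1).
  set r := 16 * e with hr
  have hr0 : 0 < r := by positivity
  have her : e < r := by linarith
  set q := e ^ 2 / σ ^ 2 with hq
  have hq1 : 1 ≤ q := by
    rw [hq, le_div_iff₀ (by positivity), one_mul]
    gcongr
  obtain ⟨S, hS⟩ := exists_maximal_isSeparated (((2 * r).toNNReal : ℝ≥0∞)) K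
  have hSK : S ⊆ K := hS.prop.1
  have hSsep : ∀ x ∈ S, ∀ y ∈ S, x ≠ y → 2 * r < dist x y :=
    (isSeparated_toNNReal_iff (by positivity)).mp hS.prop.2
  have hcov : ∀ x ∈ K, ∃ y ∈ S, ‖x - y‖ ≤ 2 * r := by
    intro x hx
    obtain ⟨y, hy, hxy⟩ := Metric.IsCover.of_maximal_isSeparated hS hx
    refine ⟨y, hy, ?_⟩
    change edist x y ≤ ENNReal.ofReal (2 * r) at hxy
    rw [edist_dist] at hxy
    rw [← dist_eq_norm]
    exact (ENNReal.ofReal_le_ofReal_iff (by positivity)).mp hxy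
  have hSne : S.Nonempty := by
    obtain ⟨x, hx⟩ := hne
    obtain ⟨y, hy, -⟩ := hcov x hx
    exact ⟨y, hy⟩
  have hfinball : ∀ θ ∈ K, ∀ k : ℕ, (S ∩ Metric.closedBall θ (r * c ^ k)).Finite := by
    intro θ hθ k
    by_contra hinf
    obtain ⟨m, hm⟩ := exists_nat_gt (Real.exp (epsStar c σ K ^ 2 / σ ^ 2) ^ k)
    obtain ⟨t, ht, htm⟩ := Set.Infinite.exists_subset_card_eq hinf m
    have := card_le_of_separated hconv hne hc hσ hr0 her k hθ (S := t)
      (fun x hx => ⟨(ht hx).2, hSK (ht hx).1⟩)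
      (fun x hx y hy => hSsep x (ht hx).1 y (ht hy).1)
    rw [htm] at this
    linarith
  have hfin : ∀ R, (S ∩ Metric.closedBall 0 R).Finite := by
    intro R
    obtain ⟨θ, hθ⟩ := hne
    obtain ⟨k, hk⟩ := pow_unbounded_of_one_lt ((R + ‖θ‖) / r) (by linarith : 1 < c)
    refine (hfinball θ hθ k).subset (inter_subset_inter_right _ ?_)
    refine Metric.closedBall_subset_closedBall' ?_
    rw [div_lt_iff₀ hr0] at hk
    rw [dist_zero_left]
    linarith
  obtain ⟨δ, hδ, hδS⟩ := exists_measurable_nearest hSne hfin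
  refine (iInf₂_le δ hδ).trans (iSup₂_le fun μ hμ => ?_)
  obtain ⟨p, hpS, hp⟩ := hcov μ hμ
  -- The sieve points between distances r c^(j+1) and r c^(j+2) from p. On `B j` one of them is at
  -- least as close to the observation as p.
  let F : ℕ → Finset (Euc n) := fun j =>
    (hfinball p (hSK hpS) (j + 2)).toFinset.filter fun x => r * c ^ (j + 1) ≤ ‖x - p‖
  have hFcard : ∀ j, ((F j).card : ℝ) ≤ Real.exp q ^ (j + 2) := by
    intro j
    refine card_le_of_separated hconv hne hc hσ hr0 her (j + 2) (hSK hpS) (fun x hx => ?_)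
      (fun x hx y hy => ?_)
    · have := (Finset.mem_filter.mp hx).1
      rw [Set.Finite.mem_toFinset] at this
      exact ⟨this.2, hSK this.1⟩
    · have h1 := (Finset.mem_filter.mp hx).1
      have h2 := (Finset.mem_filter.mp hy).1
      rw [Set.Finite.mem_toFinset] at h1 h2
      exact hSsep x h1.1 y h2.1
  let B : ℕ → Set (Euc n) := fun j => ⋃ x ∈ F j, {y | ‖y - x‖ ≤ ‖y - p‖}
  have hBm : ∀ j, MeasurableSet (B j) := fun j =>
    Finset.measurableSet_biUnion _ fun x _ => measurableSet_le (by fun_prop) (by fun_prop)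
  have hBp : ∀ j, (obsLaw σ μ).real (B j) ≤ 2 / c ^ (4 * (j + 1)) := by
    intro j
    set D := r * c ^ (j + 1) with hD
    have hD17 : 17 * r ≤ D := by
      have : (17 : ℝ) ≤ c ^ (j + 1) := hc.trans (le_self_pow₀ (by linarith) (by omega))
      nlinarith
    have eD : D ^ 2 / (32 * σ ^ 2) = 8 * q * c ^ (2 * (j + 1)) := by
      rw [hD, hq, hr, mul_pow, ← pow_mul, mul_comm (j + 1) 2]
      field_simp
      norm_num
    calc (obsLaw σ μ).real (B j)
        ≤ ∑ x ∈ F j, (obsLaw σ μ).real {y | ‖y - x‖ ≤ ‖y - p‖} :=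
          measureReal_biUnion_finset_le _ _
      _ ≤ ∑ _x ∈ F j, Real.exp (-(D ^ 2 / (32 * σ ^ 2))) := Finset.sum_le_sum fun x hx =>
          obsLaw_real_closer_le hσ hr0 hp hD17 (Finset.mem_filter.mp hx).2
      _ = (F j).card * Real.exp (-(8 * q * c ^ (2 * (j + 1)))) := by
          rw [Finset.sum_const, nsmul_eq_mul, eD]
      _ ≤ Real.exp q ^ (j + 1 + 1) * Real.exp (-(8 * q * c ^ (2 * (j + 1)))) := by
          gcongr
          exact hFcard j
      _ ≤ _ := exp_shell_le hc hq1 (j + 1)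
  have hpt : ∀ y, ‖δ y - μ‖ₑ ^ 2 ≤ ENNReal.ofReal (4 * r ^ 2 * c ^ 2) +
      ∑' j, (B j).indicator (fun _ => ENNReal.ofReal (4 * r ^ 2 * c ^ (2 * (j + 2)))) y := by
    intro y
    have hsq : ∀ a : ℝ, 0 ≤ a → ‖δ y - μ‖ ≤ 2 * (r * a) →
        ‖δ y - μ‖ₑ ^ 2 ≤ ENNReal.ofReal (4 * r ^ 2 * a ^ 2) := by
      intro a ha h
      rw [← ofReal_norm, ← ENNReal.ofReal_pow (norm_nonneg _)]
      refine ENNReal.ofReal_le_ofReal ?_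
      calc ‖δ y - μ‖ ^ 2 ≤ (2 * (r * a)) ^ 2 := by gcongr
        _ = _ := by ring
    have htri : ‖δ y - μ‖ ≤ ‖δ y - p‖ + 2 * r := by
      have := norm_sub_le_norm_sub_add_norm_sub (δ y) p μ
      rw [norm_sub_rev p μ] at this
      linarith
    rcases le_or_gt ‖δ y - p‖ (r * c) with h | h
    · refine le_add_right (hsq c hc0.le ?_)
      nlinarith
    · have h1 : c < ‖δ y - p‖ / r := by
        rw [lt_div_iff₀ hr0]
        linarith
      obtain ⟨k, hk1, hk2⟩ := exists_nat_pow_near (by linarith : 1 ≤ ‖δ y - p‖ / r)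
        (by linarith : 1 < c)
      rw [le_div_iff₀ hr0] at hk1
      rw [div_lt_iff₀ hr0] at hk2
      -- The shell of index 0 is excluded because here ‖δ y - p‖ > r c.
      obtain ⟨j, rfl⟩ : ∃ j, k = j + 1 := by
        refine ⟨k - 1, ?_⟩
        have : k ≠ 0 := by
          rintro rfl
          rw [zero_add, pow_one] at hk2
          linarith
        omega
      have hmem : y ∈ B j := by
        refine mem_iUnion₂.mpr ⟨δ y, Finset.mem_filter.mpr ⟨?_, by linarith⟩, (hδS y).2 p hpS⟩
        rw [Set.Finite.mem_toFinset]
        refine ⟨(hδS y).1, ?_⟩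
        rw [Metric.mem_closedBall, dist_eq_norm]
        linarith
      refine le_trans ?_ (le_add_left (ENNReal.le_tsum j))
      rw [indicator_of_mem hmem]
      refine (hsq (c ^ (j + 2)) (by positivity) ?_).trans_eq ?_
      · have : (17 : ℝ) ≤ c ^ (j + 2) := hc.trans (le_self_pow₀ (by linarith) (by omega))
        nlinarith
      · rw [← pow_mul, mul_comm (j + 2) 2]
  have hterm : ∀ j, ∫⁻ y, (B j).indicator
      (fun _ => ENNReal.ofReal (4 * r ^ 2 * c ^ (2 * (j + 2)))) y ∂(obsLaw σ μ) ≤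
      ENNReal.ofReal (4 * r ^ 2 * c ^ 2 * (1 / 2) ^ j) := by
    intro j
    rw [lintegral_indicator_const (hBm j), ← ofReal_measureReal (h := measure_ne_top _ _),
      ← ENNReal.ofReal_mul (by positivity)]
    refine ENNReal.ofReal_le_ofReal ?_
    calc 4 * r ^ 2 * c ^ (2 * (j + 2)) * (obsLaw σ μ).real (B j)
        ≤ 4 * r ^ 2 * c ^ (2 * (j + 2)) * (2 / c ^ (4 * (j + 1))) := by
          gcongr
          exact hBp j
      _ = 4 * r ^ 2 * c ^ 2 * (2 / c ^ (2 * (j + 1))) := by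
          rw [show 4 * (j + 1) = 2 * (j + 1) + 2 * (j + 1) by ring,
            show 2 * (j + 2) = 2 * (j + 1) + 2 by ring, pow_add, pow_add]
          field_simp
      _ ≤ 4 * r ^ 2 * c ^ 2 * (1 / 2) ^ j := by
          gcongr
          rw [one_div, inv_pow, ← one_div, div_le_div_iff₀ (by positivity) (by positivity),
            one_mul, ← pow_succ']
          rw [pow_mul]
          gcongr
          nlinarith
  calc ∫⁻ y, ‖δ y - μ‖ₑ ^ 2 ∂(obsLaw σ μ)
      ≤ ∫⁻ y, (ENNReal.ofReal (4 * r ^ 2 * c ^ 2) + ∑' j, (B j).indicator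
          (fun _ => ENNReal.ofReal (4 * r ^ 2 * c ^ (2 * (j + 2)))) y) ∂(obsLaw σ μ) :=
        lintegral_mono hpt
    _ = ENNReal.ofReal (4 * r ^ 2 * c ^ 2) + ∑' j, ∫⁻ y, (B j).indicator
          (fun _ => ENNReal.ofReal (4 * r ^ 2 * c ^ (2 * (j + 2)))) y ∂(obsLaw σ μ) := by
        rw [lintegral_add_left measurable_const, lintegral_const, measure_univ, mul_one,
          lintegral_tsum fun j => (measurable_const.indicator (hBm j)).aemeasurable]
    _ ≤ ENNReal.ofReal (4 * r ^ 2 * c ^ 2) +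
          ∑' j, ENNReal.ofReal (4 * r ^ 2 * c ^ 2 * (1 / 2) ^ j) := by
        gcongr with j
        exact hterm j
    _ = ENNReal.ofReal (12 * r ^ 2 * c ^ 2) := by
        rw [← ENNReal.ofReal_tsum_of_nonneg (fun j => by positivity)
          (summable_geometric_two.mul_left _), tsum_mul_left, tsum_geometric_two,
          ← ENNReal.ofReal_add (by positivity) (by positivity)]
        congr 1
        ring

end UpperBound

/-! ### Local Gaussian width: concavity, fluctuations and its link with the LSE. -/

section Width

variable {n : ℕ} {K T : Set (Euc n)} {μ p : Euc n} {σ : ℝ}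

/-- The support function of `T - p`. -/
noncomputable def centeredSup (T : Set (Euc n)) (p x : Euc n) : ℝ :=
  ⨆ t : T, ⟪x, (t : Euc n) - p⟫

theorem centeredSup_bddAbove (hT : IsCompact T) (p x : Euc n) :
    BddAbove (range fun t : T => ⟪x, (t : Euc n) - p⟫) := by
  have := hT.bddAbove_image (f := fun t : Euc n => ⟪x, t - p⟫) (by fun_prop)
  rwa [image_eq_range] at this

theorem inner_le_centeredSup (hT : IsCompact T) {t : Euc n} (ht : t ∈ T) (p x : Euc n) :
    ⟪x, t - p⟫ ≤ centeredSup T p x :=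
  le_ciSup (centeredSup_bddAbove hT p x) ⟨t, ht⟩

theorem centeredSup_le (hne : T.Nonempty) {x : Euc n} {b : ℝ} (h : ∀ t ∈ T, ⟪x, t - p⟫ ≤ b) :
    centeredSup T p x ≤ b :=
  have := hne.to_subtype
  ciSup_le fun t => h t t.2

theorem exists_centeredSup_eq (hT : IsCompact T) (hne : T.Nonempty) (p x : Euc n) :
    ∃ t ∈ T, centeredSup T p x = ⟪x, t - p⟫ := by
  obtain ⟨t, ht, hmax⟩ := hT.exists_isMaxOn hne
    (f := fun t : Euc n => ⟪x, t - p⟫) (by fun_prop)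
  exact ⟨t, ht, le_antisymm (centeredSup_le hne fun s hs => hmax hs)
    (inner_le_centeredSup hT ht p x)⟩

/-- A maximizer t gives the subgradient t - p. Centering at p makes the Lipschitz constant the
radius of T about p, independent of the position of T. -/
theorem hasSubgradients_centeredSup (hT : IsCompact T) (hne : T.Nonempty) {R : ℝ}
    (hTR : T ⊆ Metric.closedBall p R) : HasSubgradients (centeredSup T p) R := by
  intro x
  obtain ⟨t, ht, hx⟩ := exists_centeredSup_eq hT hne p x
  refine ⟨t - p, ?_, fun y => ?_⟩
  · rw [← dist_eq_norm]
    exact hTR ht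
  · rw [hx, inner_sub_left]
    have := inner_le_centeredSup hT ht p y
    linarith

theorem integral_inner_stdGaussian (p : Euc n) :
    ∫ x, ⟪x, p⟫ ∂(stdGaussian (Euc n)) = 0 := by
  have := integral_strongDual_stdGaussian (E := Euc n) (innerSL ℝ p)
  simpa [real_inner_comm] using this

theorem integrable_inner_stdGaussian (p : Euc n) :
    Integrable (fun x : Euc n => ⟪x, p⟫) (stdGaussian (Euc n)) := by
  have := (IsGaussian.integrable_dual (stdGaussian (Euc n)) (innerSL ℝ p))
  simpa [real_inner_comm] using this

/-- The Gaussian width does not depend on the choice of the origin. -/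
theorem gaussianWidth_eq_integral_centeredSup (hT : IsCompact T) (hne : T.Nonempty) (p : Euc n) :
    gaussianWidth T = ∫ x, centeredSup T p x ∂(stdGaussian (Euc n)) := by
  obtain ⟨R, hR⟩ := hT.isBounded.subset_closedBall p
  have hint := (hasSubgradients_centeredSup hT hne hR).integrable
  have e : ∀ x, ⨆ t : T, ⟪x, (t : Euc n)⟫ = ⟪x, p⟫ + centeredSup T p x := by
    intro x
    have h0 : ⨆ t : T, ⟪x, (t : Euc n)⟫ = centeredSup T 0 x := by simp [centeredSup]
    rw [h0]
    refine le_antisymm (centeredSup_le hne fun t ht => ?_) ?_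
    · have := inner_le_centeredSup hT ht p x
      rw [inner_sub_right] at this
      rw [sub_zero]
      linarith
    · obtain ⟨t, ht, hx⟩ := exists_centeredSup_eq hT hne p x
      have := inner_le_centeredSup hT ht 0 x
      rw [sub_zero] at this
      rw [hx, inner_sub_right]
      linarith
  unfold gaussianWidth
  simp only [e]
  rw [integral_add (integrable_inner_stdGaussian p) hint, integral_inner_stdGaussian, zero_add]

/-- The supremum of `⟪x, t - μ⟫` over the points `t` of `K` at distance at most `s` from `μ`. -/
noncomputable def localSup (K : Set (Euc n)) (μ : Euc n) (s : ℝ) (x : Euc n) : ℝ :=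
  centeredSup (Metric.closedBall μ s ∩ K) μ x

theorem isCompact_closedBall_inter (hK : IsClosed K) (μ : Euc n) (s : ℝ) :
    IsCompact (Metric.closedBall μ s ∩ K) :=
  (isCompact_closedBall μ s).inter_right hK

theorem closedBall_inter_nonempty (hμ : μ ∈ K) {s : ℝ} (hs : 0 ≤ s) :
    (Metric.closedBall μ s ∩ K).Nonempty :=
  ⟨μ, Metric.mem_closedBall_self hs, hμ⟩

theorem hasSubgradients_localSup (hK : IsClosed K) (hμ : μ ∈ K) {s : ℝ} (hs : 0 ≤ s) :
    HasSubgradients (localSup K μ s) s :=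
  hasSubgradients_centeredSup (isCompact_closedBall_inter hK μ s)
    (closedBall_inter_nonempty hμ hs) inter_subset_left

theorem localWidth_eq_integral (hK : IsClosed K) (hμ : μ ∈ K) {s : ℝ} (hs : 0 ≤ s) :
    localWidth K μ s = ∫ x, localSup K μ s x ∂(stdGaussian (Euc n)) :=
  gaussianWidth_eq_integral_centeredSup (isCompact_closedBall_inter hK μ s)
    (closedBall_inter_nonempty hμ hs) μ

theorem localSup_mono (hK : IsClosed K) (hμ : μ ∈ K) {r s : ℝ} (hr : 0 ≤ r) (hrs : r ≤ s)
    (x : Euc n) : localSup K μ r x ≤ localSup K μ s x :=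
  centeredSup_le (closedBall_inter_nonempty hμ hr) fun _ ht =>
    inner_le_centeredSup (isCompact_closedBall_inter hK μ s)
      ⟨Metric.closedBall_subset_closedBall hrs ht.1, ht.2⟩ μ x

theorem gaussianWidth_mono {T' : Set (Euc n)} (hT : IsCompact T) (hT' : IsCompact T')
    (hne : T.Nonempty) (h : T ⊆ T') : gaussianWidth T ≤ gaussianWidth T' := by
  have hne' := hne.mono h
  obtain ⟨R, hR⟩ := hT.isBounded.subset_closedBall 0
  obtain ⟨R', hR'⟩ := hT'.isBounded.subset_closedBall 0
  rw [gaussianWidth_eq_integral_centeredSup hT hne 0,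
    gaussianWidth_eq_integral_centeredSup hT' hne' 0]
  exact integral_mono (hasSubgradients_centeredSup hT hne hR).integrable
    (hasSubgradients_centeredSup hT' hne' hR').integrable
    fun x => centeredSup_le hne fun t ht => inner_le_centeredSup hT' (h ht) 0 x

theorem localWidth_mono (hK : IsClosed K) (hμ : μ ∈ K) {r s : ℝ} (hr : 0 ≤ r) (hrs : r ≤ s) :
    localWidth K μ r ≤ localWidth K μ s :=
  gaussianWidth_mono (isCompact_closedBall_inter hK μ r) (isCompact_closedBall_inter hK μ s)
    (closedBall_inter_nonempty hμ hr)
    (inter_subset_inter_left _ (Metric.closedBall_subset_closedBall hrs))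

/-- The convex combination of maximizers at radii r and u whose radii average to s is admissible at
radius s. The form without division also covers r = u. -/
theorem localSup_concave (hK : IsClosed K) (hconv : Convex ℝ K) (hμ : μ ∈ K) {r s u : ℝ}
    (hr : 0 ≤ r) (hrs : r ≤ s) (hsu : s ≤ u) (x : Euc n) :
    (u - s) * localSup K μ r x + (s - r) * localSup K μ u x ≤ (u - r) * localSup K μ s x := by
  rcases (hrs.trans hsu).eq_or_lt with h | h
  · have h1 : s = r := by linarith
    subst h1
    subst h
    simp
  obtain ⟨a, ha, hra⟩ := exists_centeredSup_eq (isCompact_closedBall_inter hK μ r)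
    (closedBall_inter_nonempty hμ hr) μ x
  obtain ⟨b, hb, hub⟩ := exists_centeredSup_eq (isCompact_closedBall_inter hK μ u)
    (closedBall_inter_nonempty hμ (hr.trans (hrs.trans hsu))) μ x
  have hd : 0 < u - r := by linarith
  set α := (u - s) / (u - r) with hα
  set β := (s - r) / (u - r) with hβ
  have hα0 : 0 ≤ α := div_nonneg (by linarith) hd.le
  have hβ0 : 0 ≤ β := div_nonneg (by linarith) hd.le
  have hαβ : α + β = 1 := by
    rw [hα, hβ, ← add_div]
    rw [show u - s + (s - r) = u - r by ring, div_self hd.ne']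
  have e : α • a + β • b - μ = α • (a - μ) + β • (b - μ) := by
    have : μ = (α + β) • μ := by rw [hαβ, one_smul]
    nth_rewrite 1 [this]
    module
  have hmem : α • a + β • b ∈ Metric.closedBall μ s ∩ K := by
    refine ⟨?_, hconv ha.2 hb.2 hα0 hβ0 hαβ⟩
    have h1 := Metric.mem_closedBall.mp ha.1
    have h2 := Metric.mem_closedBall.mp hb.1
    rw [dist_eq_norm] at h1 h2
    rw [Metric.mem_closedBall, dist_eq_norm, e]
    calc ‖α • (a - μ) + β • (b - μ)‖ ≤ ‖α • (a - μ)‖ + ‖β • (b - μ)‖ := norm_add_le _ _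
      _ = α * ‖a - μ‖ + β * ‖b - μ‖ := by
          rw [norm_smul, norm_smul, Real.norm_of_nonneg hα0, Real.norm_of_nonneg hβ0]
      _ ≤ α * r + β * u := by gcongr
      _ = s := by rw [hα, hβ]; field_simp; ring
  have h1 := inner_le_centeredSup (isCompact_closedBall_inter hK μ s) hmem μ x
  rw [e, inner_add_right, real_inner_smul_right, real_inner_smul_right, ← hra, ← hub] at h1
  have h2 := mul_le_mul_of_nonneg_left h1 hd.le
  have e1 : (u - r) * α = u - s := by rw [hα]; field_simp
  have e2 : (u - r) * β = s - r := by rw [hβ]; field_simp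
  unfold localSup
  calc _ = (u - r) * (α * centeredSup (Metric.closedBall μ r ∩ K) μ x +
        β * centeredSup (Metric.closedBall μ u ∩ K) μ x) := by
        rw [mul_add, ← mul_assoc, ← mul_assoc, e1, e2]
    _ ≤ _ := h2

theorem localWidth_concave (hK : IsClosed K) (hconv : Convex ℝ K) (hμ : μ ∈ K) {r s u : ℝ}
    (hr : 0 ≤ r) (hrs : r ≤ s) (hsu : s ≤ u) :
    (u - s) * localWidth K μ r + (s - r) * localWidth K μ u ≤ (u - r) * localWidth K μ s := by
  have hs := hr.trans hrs
  have hu := hs.trans hsu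
  have ir := (hasSubgradients_localSup hK hμ hr).integrable
  have is := (hasSubgradients_localSup hK hμ hs).integrable
  have iu := (hasSubgradients_localSup hK hμ hu).integrable
  rw [localWidth_eq_integral hK hμ hr, localWidth_eq_integral hK hμ hs,
    localWidth_eq_integral hK hμ hu, ← integral_const_mul, ← integral_const_mul,
    ← integral_const_mul, ← integral_add (ir.const_mul _) (iu.const_mul _)]
  exact integral_mono ((ir.const_mul _).add (iu.const_mul _)) (is.const_mul _)
    fun x => localSup_concave hK hconv hμ hr hrs hsu x

/-- The distance from the LSE to the truth maximizes `s ↦ σ · localSup s - s² / 2`. -/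
theorem lse_localSup (hK : IsClosed K) (hμ : μ ∈ K) (hσ : 0 < σ) {s : ℝ} (hs : 0 ≤ s)
    (z : Euc n) :
    σ * localSup K μ s z - s ^ 2 / 2 ≤
      σ * localSup K μ ‖lse K (μ + σ • z) - μ‖ z - ‖lse K (μ + σ • z) - μ‖ ^ 2 / 2 := by
  obtain ⟨hm, hmin⟩ := lse_spec hK ⟨μ, hμ⟩ (μ + σ • z)
  set m := lse K (μ + σ • z)
  obtain ⟨a, ha, has⟩ := exists_centeredSup_eq (isCompact_closedBall_inter hK μ s)
    (closedBall_inter_nonempty hμ hs) μ z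
  -- Up to a term independent of ν, minimizing the squared residual is maximizing σ⟪z, ν - μ⟫ - ‖ν -
  -- μ‖²/2.
  have key : ∀ ν : Euc n, ‖μ + σ • z - ν‖ ^ 2 =
      σ ^ 2 * ‖z‖ ^ 2 - 2 * (σ * ⟪z, ν - μ⟫) + ‖ν - μ‖ ^ 2 := by
    intro ν
    have : μ + σ • z - ν = σ • z - (ν - μ) := by abel
    rw [this, norm_sub_sq_real, norm_smul, real_inner_smul_left, mul_pow, Real.norm_eq_abs, sq_abs]
  have h1 := hmin a ha.2
  rw [key, key] at h1
  have h2 : ⟪z, m - μ⟫ ≤ localSup K μ ‖m - μ‖ z :=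
    inner_le_centeredSup (isCompact_closedBall_inter hK μ _)
      ⟨by rw [Metric.mem_closedBall, dist_eq_norm], hm⟩ μ z
  have h3 : ‖a - μ‖ ^ 2 ≤ s ^ 2 := by
    have := Metric.mem_closedBall.mp ha.1
    rw [dist_eq_norm] at this
    gcongr
  have h4 : localSup K μ s z = ⟪z, a - μ⟫ := has
  rw [h4]
  have h5 : σ * ⟪z, m - μ⟫ ≤ σ * localSup K μ ‖m - μ‖ z := by gcongr
  linarith

/-- Variance of the increment of `localSup` between two radii. -/
theorem integral_sq_localSup_sub_le (hK : IsClosed K) (hμ : μ ∈ K) {r s : ℝ} (hr : 0 < r)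
    (hrs : r ≤ s) :
    ∫ x, (localSup K μ s x - localSup K μ r x - (localWidth K μ s - localWidth K μ r)) ^ 2
        ∂(stdGaussian (Euc n)) ≤ 128 * s ^ 2 := by
  have hs := hr.trans_le hrs
  have fr := hasSubgradients_localSup hK hμ hr.le
  have fs := hasSubgradients_localSup hK hμ hs.le
  have vr := fr.integral_sq_centered_le hr
  have vs := fs.integral_sq_centered_le hs
  rw [← localWidth_eq_integral hK hμ hr.le] at vr
  rw [← localWidth_eq_integral hK hμ hs.le] at vs
  have ir : Integrable (fun x => (localSup K μ r x - localWidth K μ r) ^ 2)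
      (stdGaussian (Euc n)) := (fr.memLp_two.sub (memLp_const _)).integrable_sq
  have is : Integrable (fun x => (localSup K μ s x - localWidth K μ s) ^ 2)
      (stdGaussian (Euc n)) := (fs.memLp_two.sub (memLp_const _)).integrable_sq
  have hsq : r ^ 2 ≤ s ^ 2 := by gcongr
  calc _ ≤ ∫ x, (2 * (localSup K μ s x - localWidth K μ s) ^ 2 +
        2 * (localSup K μ r x - localWidth K μ r) ^ 2) ∂(stdGaussian (Euc n)) := by
        refine integral_mono_of_nonneg (ae_of_all _ fun _ => sq_nonneg _)
          ((is.const_mul 2).add (ir.const_mul 2)) (ae_of_all _ fun x => ?_)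
        simp only
        nlinarith [sq_nonneg (localSup K μ s x - localWidth K μ s +
          (localSup K μ r x - localWidth K μ r))]
    _ ≤ 128 * s ^ 2 := by
        rw [integral_add (is.const_mul 2) (ir.const_mul 2), integral_const_mul,
          integral_const_mul]
        linarith

end Width

/-! ### Equivalence of LSE optimality and the Lipschitz property of the width. -/

section Characterization

variable {n : ℕ} {K : Set (Euc n)} {μ : Euc n} {σ : ℝ}

/-- The change of variables is a homeomorphism, so no measurability of f is required; this avoids
proving that `lse` is measurable. -/
theorem lintegral_obsLaw (hσ : 0 < σ) (μ : Euc n) (f : Euc n → ℝ≥0∞) :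
    ∫⁻ y, f y ∂(obsLaw σ μ) = ∫⁻ z, f (μ + σ • z) ∂(stdGaussian (Euc n)) := by
  have h : MeasurableEmbedding fun z : Euc n => μ + σ • z :=
    ((Homeomorph.smulOfNeZero σ hσ.ne').trans (Homeomorph.addLeft μ)).measurableEmbedding
  exact h.lintegral_map f

theorem lintegral_lse_le_worstRisk (hσ : 0 < σ) (hμ : μ ∈ K) :
    ∫⁻ z, ‖lse K (μ + σ • z) - μ‖ₑ ^ 2 ∂(stdGaussian (Euc n)) ≤ worstRisk σ K (lse K) := by
  rw [← lintegral_obsLaw hσ μ fun y => ‖lse K y - μ‖ₑ ^ 2]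
  exact le_iSup₂_of_le (f := fun μ _ => ∫⁻ y, ‖lse K y - μ‖ₑ ^ 2 ∂(obsLaw σ μ)) μ hμ le_rfl

/-- A risk bound for the LSE bounds the increments of the local width. -/
theorem localWidth_sub_le_of_worstRisk_le (hK : IsClosed K) (hμ : μ ∈ K) (hσ : 0 < σ)
    {R r ε : ℝ} (hrisk : worstRisk σ K (lse K) ≤ ENNReal.ofReal R) (hr : 0 < r)
    (hRr : 4 * R ≤ r ^ 2) (hrε : r ≤ ε) :
    localWidth K μ ε - localWidth K μ r ≤ ε ^ 2 / (2 * σ) + 14 * ε := by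
  have hε : 0 < ε := hr.trans_le hrε
  set m := localWidth K μ ε - localWidth K μ r with hm
  set Y : Euc n → ℝ := fun x => localSup K μ ε x - localSup K μ r x with hY
  have fε := hasSubgradients_localSup hK hμ hε.le
  have fr := hasSubgradients_localSup hK hμ hr.le
  have hYc : Continuous Y := fε.continuous.sub fr.continuous
  set G : Set (Euc n) := {x | ε ^ 2 / (2 * σ) < Y x} with hG
  have hGm : MeasurableSet G := measurableSet_lt measurable_const hYc.measurable
  -- On G the radius ε beats every radius below r in the variational problem of `lse_localSup`.
  -- Markov's inequality for the risk then gives P(G) ≤ 1/4.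
  have hfar : ∀ z ∈ G, r ≤ ‖lse K (μ + σ • z) - μ‖ := by
    intro z hz
    by_contra! hlt
    have h1 := lse_localSup hK hμ hσ hε.le z
    set t := ‖lse K (μ + σ • z) - μ‖
    have h2 := localSup_mono hK hμ (norm_nonneg _ : 0 ≤ t) hlt.le z
    have hz' : ε ^ 2 / (2 * σ) < localSup K μ ε z - localSup K μ r z := hz
    rw [div_lt_iff₀ (by positivity)] at hz'
    have h3 : σ * localSup K μ t z ≤ σ * localSup K μ r z := by gcongr
    nlinarith [sq_nonneg t]
  have hprob : (stdGaussian (Euc n)).real G ≤ 1 / 4 := by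
    have h1 : ENNReal.ofReal (r ^ 2 * (stdGaussian (Euc n)).real G) ≤ ENNReal.ofReal R := by
      calc ENNReal.ofReal (r ^ 2 * (stdGaussian (Euc n)).real G)
          = ∫⁻ _z in G, ENNReal.ofReal (r ^ 2) ∂(stdGaussian (Euc n)) := by
            rw [setLIntegral_const, ENNReal.ofReal_mul (by positivity), ofReal_measureReal]
        _ ≤ ∫⁻ z in G, ‖lse K (μ + σ • z) - μ‖ₑ ^ 2 ∂(stdGaussian (Euc n)) := by
            refine setLIntegral_mono' hGm fun z hz => ?_
            rw [← ofReal_norm, ← ENNReal.ofReal_pow (norm_nonneg _)]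
            have := hfar z hz
            gcongr
        _ ≤ ∫⁻ z, ‖lse K (μ + σ • z) - μ‖ₑ ^ 2 ∂(stdGaussian (Euc n)) :=
            setLIntegral_le_lintegral _ _
        _ ≤ ENNReal.ofReal R := (lintegral_lse_le_worstRisk hσ hμ).trans hrisk
    have hr2 : 0 < r ^ 2 := by positivity
    rcases le_or_gt R 0 with hR | hR
    · rw [ENNReal.ofReal_of_nonpos hR, nonpos_iff_eq_zero, ENNReal.ofReal_eq_zero] at h1
      have : (stdGaussian (Euc n)).real G ≤ 0 := by
        by_contra! h
        have := mul_pos hr2 h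
        linarith
      linarith
    · rw [ENNReal.ofReal_le_ofReal_iff hR.le] at h1
      have : r ^ 2 * (stdGaussian (Euc n)).real G ≤ r ^ 2 * (1 / 4) := by linarith
      exact le_of_mul_le_mul_left this hr2
  by_contra! hcon
  have hvar := integral_sq_localSup_sub_le hK hμ hr hrε
  rw [← hm] at hvar
  have hint : Integrable (fun x => (Y x - m) ^ 2) (stdGaussian (Euc n)) :=
    ((fε.memLp_two.sub fr.memLp_two).sub (memLp_const m)).integrable_sq
  have hmarkov := mul_meas_ge_le_integral_of_nonneg
    (ae_of_all (stdGaussian (Euc n)) fun x => sq_nonneg (Y x - m)) hint (196 * ε ^ 2)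
  -- If the mean increment were too large, an event of probability at least 3/4 would lie 14ε below
  -- the mean. Chebyshev excludes this, since 196 · 3/4 = 147 > 128.
  have hsub : Gᶜ ⊆ {x | 196 * ε ^ 2 ≤ (Y x - m) ^ 2} := by
    intro x hx
    have h1 : Y x ≤ ε ^ 2 / (2 * σ) := not_lt.mp hx
    have h2 : 14 * ε ≤ m - Y x := by linarith
    change 196 * ε ^ 2 ≤ (Y x - m) ^ 2
    nlinarith
  have h3 : 3 / 4 ≤ (stdGaussian (Euc n)).real {x | 196 * ε ^ 2 ≤ (Y x - m) ^ 2} := by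
    have := measureReal_mono (μ := stdGaussian (Euc n)) hsub
    rw [probReal_compl_eq_one_sub hGm] at this
    linarith
  have h4 : 196 * ε ^ 2 * (3 / 4) ≤ 128 * ε ^ 2 := by
    calc 196 * ε ^ 2 * (3 / 4)
        ≤ 196 * ε ^ 2 * (stdGaussian (Euc n)).real {x | 196 * ε ^ 2 ≤ (Y x - m) ^ 2} := by
          gcongr
      _ ≤ _ := hmarkov
      _ ≤ _ := hvar
  nlinarith [pow_pos hε 2]

theorem localWidth_le_add (hK : IsClosed K) {ν : Euc n} (hν : ν ∈ K) {ε : ℝ} (hε : 0 ≤ ε) :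
    localWidth K ν ε ≤ localWidth K μ (ε + dist ν μ) :=
  gaussianWidth_mono (isCompact_closedBall_inter hK ν ε) (isCompact_closedBall_inter hK μ _)
    (closedBall_inter_nonempty hν hε)
    (inter_subset_inter_left _ (Metric.closedBall_subset_closedBall' le_rfl))

theorem localWidth_eq_gaussianWidth {ε : ℝ} (h : ∀ ν ∈ K, dist ν μ ≤ ε) :
    localWidth K μ ε = gaussianWidth K := by
  unfold localWidth
  rw [inter_eq_right.mpr fun ν hν => Metric.mem_closedBall.mpr (h ν hν)]

/-- If ε* < σ, every ball considered contains K and the width is constant. Otherwise the constant B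
is chosen so that r = B ε* satisfies 4R ≤ r² for the risk bound R given by optimality. -/
theorem widthLipschitz_of_lseOptimal {c A : ℝ} (hc : 17 ≤ c) (hA : 0 < A) (hK : IsClosed K)
    (hconv : Convex ℝ K) (hne : K.Nonempty) (hσ : 0 < σ) (hopt : LSEOptimal A σ K) :
    WidthLipschitz c (2 * (1 + 128 * (1 + A) * c)) 29 σ K := by
  set e := epsStar c σ K with he
  set B := 1 + 128 * (1 + A) * c with hB
  have hB1 : 1 ≤ B := by
    have : 0 ≤ 128 * (1 + A) * c := by positivity
    linarith
  intro ε hε hεe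
  have he0 : 0 ≤ e := epsStar_nonneg
  refine LipschitzOnWith.of_dist_le_mul fun ν hν μ hμ => ?_
  rw [Real.coe_toNNReal _ (by positivity)]
  rcases lt_or_ge e σ with hlt | hge
  · have hdiam : ∀ p ∈ K, ∀ q ∈ K, dist q p ≤ ε := by
      intro p hp q hq
      have := dist_le_epsStar_of_lt hconv hc hσ hlt hq hp
      nlinarith
    rw [localWidth_eq_gaussianWidth (hdiam ν hν), localWidth_eq_gaussianWidth (hdiam μ hμ),
      dist_self]
    positivity
  · have hepos : 0 < e := hσ.trans_le hge
    have hr : 0 < B * e := by positivity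
    have hεr : 2 * (B * e) ≤ ε := by linarith
    have hσε : σ ≤ ε := by nlinarith
    have hrisk : worstRisk σ K (lse K) ≤ ENNReal.ofReal (A * (12 * (16 * e) ^ 2 * c ^ 2)) := by
      refine hopt.trans ?_
      rw [ENNReal.ofReal_mul hA.le]
      gcongr
      exact minimaxRisk_le hconv hne hc hσ hge
    have hRr : 4 * (A * (12 * (16 * e) ^ 2 * c ^ 2)) ≤ (B * e) ^ 2 := by
      have h1 : (128 * (1 + A) * c) ^ 2 ≤ B ^ 2 := by
        rw [hB]
        gcongr
        linarith
      have h2 : 12288 * A ≤ (128 * (1 + A)) ^ 2 := by nlinarith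
      calc 4 * (A * (12 * (16 * e) ^ 2 * c ^ 2)) = 12288 * A * (c ^ 2 * e ^ 2) := by ring
        _ ≤ (128 * (1 + A)) ^ 2 * (c ^ 2 * e ^ 2) := by gcongr
        _ = (128 * (1 + A) * c) ^ 2 * e ^ 2 := by ring
        _ ≤ B ^ 2 * e ^ 2 := by gcongr
        _ = _ := by ring
    have hhalf : ∀ p ∈ K, ∀ q ∈ K,
        localWidth K q ε - localWidth K p ε ≤ 29 * (ε / σ) * dist q p := by
      intro p hp q hq
      have h1 := localWidth_sub_le_of_worstRisk_le hK hp hσ hrisk hr hRr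
        (by linarith : B * e ≤ ε)
      -- The slope of w_p on [ε, ε + d] is at most its slope on [r, ε], whose length is at least
      -- ε/2: this doubles 29/2 to 29.
      have h2 := localWidth_concave hK hconv hp hr.le (by linarith : B * e ≤ ε)
        (le_add_of_nonneg_right dist_nonneg : ε ≤ ε + dist q p)
      have h3 := localWidth_le_add (μ := p) hK hq hε.le
      set d := dist q p with hd
      have hd0 : 0 ≤ d := dist_nonneg
      set r := B * e
      have h4 : ε ^ 2 / (2 * σ) + 14 * ε ≤ 29 / 2 * (ε ^ 2 / σ) := by
        have : ε ≤ ε ^ 2 / σ := by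
          rw [le_div_iff₀ hσ]
          nlinarith
        have e1 : ε ^ 2 / (2 * σ) = 1 / 2 * (ε ^ 2 / σ) := by ring
        linarith
      have h5 : (ε - r) * (localWidth K p (ε + d) - localWidth K p ε) ≤
          d * (29 / 2 * (ε ^ 2 / σ)) := by
        have : d * (localWidth K p ε - localWidth K p r) ≤ d * (29 / 2 * (ε ^ 2 / σ)) :=
          mul_le_mul_of_nonneg_left (h1.trans h4) hd0
        linarith
      have h6 := localWidth_mono hK hp hε.le (le_add_of_nonneg_right hd0 : ε ≤ ε + d)
      have h7 : ε / 2 * (localWidth K p (ε + d) - localWidth K p ε) ≤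
          ε / 2 * (29 * (ε / σ) * d) := by
        calc ε / 2 * (localWidth K p (ε + d) - localWidth K p ε)
            ≤ (ε - r) * (localWidth K p (ε + d) - localWidth K p ε) := by
              refine mul_le_mul_of_nonneg_right ?_ ?_ <;> linarith
          _ ≤ d * (29 / 2 * (ε ^ 2 / σ)) := h5
          _ = _ := by ring
      have h8 := le_of_mul_le_mul_left h7 (by positivity)
      linarith
    rw [Real.dist_eq]
    refine abs_le.mpr ⟨?_, hhalf μ hμ ν hν⟩
    have := hhalf ν hν μ hμ
    rw [dist_comm] at this
    linarith

/-- Covering the ball at one scale below controls the increment of a Lipschitz local width. -/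
theorem localWidth_sub_le_of_lipschitz {c L ε : ℝ} (hc : 17 ≤ c) (hL : 0 < L) (hK : IsClosed K)
    (hconv : Convex ℝ K) (hσ : 0 < σ) (hμ : μ ∈ K) (hε : epsStar c σ K < ε)
    (hlip : LipschitzOnWith (L * (ε / c / σ)).toNNReal (fun μ => localWidth K μ (ε / c)) K) :
    localWidth K μ ε - localWidth K μ (ε / c) ≤ (L + 9) * (ε ^ 2 / σ) := by
  have hc0 : 0 < c := by linarith
  have hε0 : 0 < ε := epsStar_nonneg.trans_lt hε
  have hδ : 0 < ε / c := by positivity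
  have hδε : ε / c ≤ ε := div_le_self hε0.le (by linarith)
  obtain ⟨N, hNcard, hN, hcov⟩ := exists_cover hc0 hε0.le hμ
  have hf : ∀ ν ∈ N,
      HasSubgradients (centeredSup (Metric.closedBall ν (ε / c) ∩ K) μ) (2 * ε) := by
    intro ν hν
    refine hasSubgradients_centeredSup (isCompact_closedBall_inter hK ν _)
      (closedBall_inter_nonempty (hN ν hν).2 hδ.le) (inter_subset_left.trans ?_)
    refine Metric.closedBall_subset_closedBall' ?_
    have := Metric.mem_closedBall.mp (hN ν hν).1
    linarith
  have hmean : ∀ ν ∈ N, ∫ x, centeredSup (Metric.closedBall ν (ε / c) ∩ K) μ x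
      ∂(stdGaussian (Euc n)) ≤ localWidth K μ (ε / c) + L * (ε ^ 2 / σ) := by
    intro ν hν
    rw [← gaussianWidth_eq_integral_centeredSup (isCompact_closedBall_inter hK ν _)
      (closedBall_inter_nonempty (hN ν hν).2 hδ.le) μ]
    have h1 := hlip.dist_le_mul ν (hN ν hν).2 μ hμ
    rw [Real.coe_toNNReal _ (by positivity), Real.dist_eq] at h1
    have h2 : gaussianWidth (Metric.closedBall ν (ε / c) ∩ K) - localWidth K μ (ε / c) ≤ _ :=
      (le_abs_self _).trans h1
    have h3 : L * (ε / c / σ) * dist ν μ ≤ L * (ε / σ) * ε := by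
      have := Metric.mem_closedBall.mp (hN ν hν).1
      gcongr
    have e1 : L * (ε / σ) * ε = L * (ε ^ 2 / σ) := by ring
    linarith
  -- All pieces are centred at μ, so they are 2ε-Lipschitz and cover `localSup K μ ε` pointwise.
  -- With l = 1/σ the entropy term contributes ε²/σ and the concentration term 8ε²/σ, whence L + 9.
  have hmax := integral_le_of_le_sup N hf (hasSubgradients_localSup hK hμ hε0.le).integrable
    (fun x => by
      obtain ⟨t, ht, hx⟩ := exists_centeredSup_eq (isCompact_closedBall_inter hK μ ε)
        (closedBall_inter_nonempty hμ hε0.le) μ x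
      obtain ⟨ν, hν, htν⟩ := hcov t ht
      refine ⟨ν, hν, ?_⟩
      change centeredSup _ _ _ ≤ _
      rw [hx]
      exact inner_le_centeredSup (isCompact_closedBall_inter hK ν _)
        ⟨Metric.mem_closedBall.mpr htν, ht.2⟩ μ x)
    hmean (l := 1 / σ) (by positivity)
  rw [← localWidth_eq_integral hK hμ hε0.le] at hmax
  have hlog : Real.log N.card ≤ ε ^ 2 / σ ^ 2 := by
    have h1 : Real.log N.card ≤ localEntropy c K ε := by
      have hpos : 0 < N.card := by
        obtain ⟨ν, hν, -⟩ := hcov μ ⟨Metric.mem_closedBall_self hε0.le, hμ⟩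
        exact Finset.card_pos.mpr ⟨ν, hν⟩
      unfold localEntropy
      gcongr
    refine h1.trans ((localEntropy_le_of_epsStar_lt hconv ⟨μ, hμ⟩ hc0 hσ hε).trans ?_)
    have := epsStar_nonneg (c := c) (σ := σ) (K := K)
    gcongr
  have h1 : Real.log N.card / (1 / σ) ≤ ε ^ 2 / σ := by
    rw [div_div_eq_mul_div, div_one]
    calc Real.log N.card * σ ≤ ε ^ 2 / σ ^ 2 * σ := by gcongr
      _ = ε ^ 2 / σ := by field_simp
  have e2 : 2 * (1 / σ) * (2 * ε) ^ 2 = 8 * (ε ^ 2 / σ) := by ring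
  linarith

/-- Increments of the local width control the risk of the LSE. -/
theorem lintegral_lse_le (hK : IsClosed K) (hconv : Convex ℝ K) (hσ : 0 < σ) (hμ : μ ∈ K)
    {r ε D : ℝ} (hr : 0 < r) (hrε : 2 * r ≤ ε) (hσε : σ ≤ ε)
    (hD : localWidth K μ ε - localWidth K μ r ≤ D * (ε ^ 2 / σ)) :
    ∫⁻ z, ‖lse K (μ + σ • z) - μ‖ₑ ^ 2 ∂(stdGaussian (Euc n)) ≤
      ENNReal.ofReal ((4097 + 32 * D ^ 2) * ε ^ 2) := by
  have hε : 0 < ε := by linarith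
  have hrε' : r ≤ ε := by linarith
  set m := localWidth K μ ε - localWidth K μ r with hm
  have hm0 : 0 ≤ m := sub_nonneg.mpr (localWidth_mono hK hμ hr.le hrε')
  set Y : Euc n → ℝ := fun x => localSup K μ ε x - localSup K μ r x with hY
  have fε := hasSubgradients_localSup hK hμ hε.le
  have fr := hasSubgradients_localSup hK hμ hr.le
  have hvar : ∫ x, (Y x - m) ^ 2 ∂(stdGaussian (Euc n)) ≤ 128 * ε ^ 2 :=
    integral_sq_localSup_sub_le hK hμ hr hrε'
  have hint : Integrable (fun x => (Y x - m) ^ 2) (stdGaussian (Euc n)) :=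
    ((fε.memLp_two.sub fr.memLp_two).sub (memLp_const m)).integrable_sq
  have hpt : ∀ z, ‖lse K (μ + σ • z) - μ‖ ^ 2 ≤
      (ε ^ 2 + 32 * σ ^ 2 / ε ^ 2 * m ^ 2) + 32 * σ ^ 2 / ε ^ 2 * (Y z - m) ^ 2 := by
    intro z
    have h1 := lse_localSup hK hμ hσ hr.le z
    set t := ‖lse K (μ + σ • z) - μ‖ with ht
    have ht0 : 0 ≤ t := norm_nonneg _
    rcases le_or_gt t ε with h | h
    · have : t ^ 2 ≤ ε ^ 2 := by gcongr
      have : 0 ≤ 32 * σ ^ 2 / ε ^ 2 * m ^ 2 := by positivity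
      have : 0 ≤ 32 * σ ^ 2 / ε ^ 2 * (Y z - m) ^ 2 := by positivity
      linarith
    · have h2 := localSup_concave hK hconv hμ hr.le hrε' h.le z
      have h3 : (ε - r) * (localSup K μ t z - localSup K μ r z) ≤ (t - r) * Y z := by
        simp only [hY]
        linarith
      -- Optimality of t against r, combined with concavity of h_μ. After cancelling t - r the bound
      -- is linear in t, and ε - r ≥ ε/2 gives the constant 4.
      have h4 : (t - r) * ((ε - r) * (t + r) / 2) ≤ (t - r) * (σ * Y z) := by
        have h5 : (t ^ 2 - r ^ 2) / 2 ≤ σ * (localSup K μ t z - localSup K μ r z) := by linarith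
        calc (t - r) * ((ε - r) * (t + r) / 2) = (ε - r) * ((t ^ 2 - r ^ 2) / 2) := by ring
          _ ≤ (ε - r) * (σ * (localSup K μ t z - localSup K μ r z)) :=
              mul_le_mul_of_nonneg_left h5 (by linarith)
          _ = σ * ((ε - r) * (localSup K μ t z - localSup K μ r z)) := by ring
          _ ≤ σ * ((t - r) * Y z) := by gcongr
          _ = _ := by ring
      have h5 := le_of_mul_le_mul_left h4 (by linarith : 0 < t - r)
      have h6 : t ≤ 4 * σ / ε * Y z := by
        rw [div_mul_eq_mul_div, le_div_iff₀ hε]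
        nlinarith
      have h7 : t ^ 2 ≤ 16 * σ ^ 2 / ε ^ 2 * Y z ^ 2 := by
        calc t ^ 2 ≤ (4 * σ / ε * Y z) ^ 2 := by gcongr
          _ = _ := by ring
      have h8 : Y z ^ 2 ≤ 2 * m ^ 2 + 2 * (Y z - m) ^ 2 := by
        nlinarith [sq_nonneg (Y z - 2 * m)]
      calc t ^ 2 ≤ 16 * σ ^ 2 / ε ^ 2 * (2 * m ^ 2 + 2 * (Y z - m) ^ 2) :=
            h7.trans (by gcongr)
        _ = 32 * σ ^ 2 / ε ^ 2 * m ^ 2 + 32 * σ ^ 2 / ε ^ 2 * (Y z - m) ^ 2 := by ring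
        _ ≤ _ := by nlinarith [sq_nonneg ε]
  have hint2 : Integrable (fun z => (ε ^ 2 + 32 * σ ^ 2 / ε ^ 2 * m ^ 2) +
      32 * σ ^ 2 / ε ^ 2 * (Y z - m) ^ 2) (stdGaussian (Euc n)) :=
    (integrable_const _).add (hint.const_mul _)
  calc ∫⁻ z, ‖lse K (μ + σ • z) - μ‖ₑ ^ 2 ∂(stdGaussian (Euc n))
      ≤ ∫⁻ z, ENNReal.ofReal ((ε ^ 2 + 32 * σ ^ 2 / ε ^ 2 * m ^ 2) +
          32 * σ ^ 2 / ε ^ 2 * (Y z - m) ^ 2) ∂(stdGaussian (Euc n)) := by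
        refine lintegral_mono fun z => ?_
        rw [← ofReal_norm, ← ENNReal.ofReal_pow (norm_nonneg _)]
        exact ENNReal.ofReal_le_ofReal (hpt z)
    _ = ENNReal.ofReal (∫ z, ((ε ^ 2 + 32 * σ ^ 2 / ε ^ 2 * m ^ 2) +
          32 * σ ^ 2 / ε ^ 2 * (Y z - m) ^ 2) ∂(stdGaussian (Euc n))) := by
        rw [ofReal_integral_eq_lintegral_ofReal hint2 (ae_of_all _ fun z => by positivity)]
    _ ≤ ENNReal.ofReal ((4097 + 32 * D ^ 2) * ε ^ 2) := by
        refine ENNReal.ofReal_le_ofReal ?_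
        rw [integral_add (integrable_const _) (hint.const_mul _), integral_const_mul,
          integral_const, probReal_univ, one_smul]
        have h1 : 32 * σ ^ 2 / ε ^ 2 * m ^ 2 ≤ 32 * D ^ 2 * ε ^ 2 := by
          calc 32 * σ ^ 2 / ε ^ 2 * m ^ 2 ≤ 32 * σ ^ 2 / ε ^ 2 * (D * (ε ^ 2 / σ)) ^ 2 := by gcongr
            _ = _ := by field_simp
        have h2 : 32 * σ ^ 2 / ε ^ 2 * ∫ x, (Y x - m) ^ 2 ∂(stdGaussian (Euc n)) ≤
            4096 * ε ^ 2 := by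
          calc _ ≤ 32 * σ ^ 2 / ε ^ 2 * (128 * ε ^ 2) := by gcongr
            _ = 4096 * σ ^ 2 := by
                field_simp
                norm_num
            _ ≤ _ := by gcongr
        linarith

theorem lseOptimal_of_worstRisk_le {c C : ℝ} (hc : 17 ≤ c) (hC : 0 ≤ C)
    (hconv : Convex ℝ K) (hne : K.Nonempty) (hσ : 0 < σ)
    (h : worstRisk σ K (lse K) ≤ ENNReal.ofReal (C * epsStar c σ K ^ 2)) :
    LSEOptimal (32 * c ^ 4 * C) σ K := by
  have hc0 : 0 < c := by linarith
  refine h.trans ?_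
  calc ENNReal.ofReal (C * epsStar c σ K ^ 2)
      = ENNReal.ofReal (32 * c ^ 4 * C) * ENNReal.ofReal (epsStar c σ K ^ 2 / (32 * c ^ 4)) := by
        rw [← ENNReal.ofReal_mul (by positivity)]
        congr 1
        field_simp
    _ ≤ _ := by
        gcongr
        exact ofReal_epsStar_sq_le_minimaxRisk hconv hne hc hσ

/-- If ε* < σ, the LSE errs by at most the diameter of K, hence by at most ε*. Otherwise ε is a
multiple of ε* for which ε/c exceeds both ε* and a ε*, so the Lipschitz hypothesis applies at radius
ε/c. -/
theorem lseOptimal_of_widthLipschitz {c a L : ℝ} (hc : 17 ≤ c) (ha : 0 < a) (hL : 0 < L)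
    (hK : IsClosed K) (hconv : Convex ℝ K) (hne : K.Nonempty) (hσ : 0 < σ)
    (hlip : WidthLipschitz c a L σ K) :
    LSEOptimal (32 * c ^ 4 * ((4097 + 32 * (L + 9) ^ 2) * (2 * (1 + a) * c) ^ 2)) σ K := by
  have hc0 : 0 < c := by linarith
  refine lseOptimal_of_worstRisk_le hc (by positivity) hconv hne hσ (iSup₂_le fun μ hμ => ?_)
  rw [lintegral_obsLaw hσ μ fun y => ‖lse K y - μ‖ₑ ^ 2]
  set e := epsStar c σ K with he
  have he0 : 0 ≤ e := epsStar_nonneg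
  rcases lt_or_ge e σ with hlt | hge
  · have hone : (1 : ℝ) ≤ (4097 + 32 * (L + 9) ^ 2) * (2 * (1 + a) * c) ^ 2 := by
      have h1 : (1 : ℝ) ≤ 2 * (1 + a) * c := by nlinarith
      have h2 : (1 : ℝ) ≤ (2 * (1 + a) * c) ^ 2 := one_le_pow₀ h1
      nlinarith [sq_nonneg (L + 9)]
    calc ∫⁻ z, ‖lse K (μ + σ • z) - μ‖ₑ ^ 2 ∂(stdGaussian (Euc n))
        ≤ ∫⁻ _z, ENNReal.ofReal (e ^ 2) ∂(stdGaussian (Euc n)) := by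
          refine lintegral_mono fun z => ?_
          rw [← ofReal_norm, ← ENNReal.ofReal_pow (norm_nonneg _), ← dist_eq_norm]
          have := dist_le_epsStar_of_lt hconv hc hσ hlt (lse_spec hK hne (μ + σ • z)).1 hμ
          gcongr
      _ = ENNReal.ofReal (e ^ 2) := by simp
      _ ≤ _ := by
          refine ENNReal.ofReal_le_ofReal ?_
          nlinarith [sq_nonneg e]
  · have hepos : 0 < e := hσ.trans_le hge
    set ε := 2 * (1 + a) * c * e with hε
    have hδ : ε / c = 2 * (1 + a) * e := by rw [hε]; field_simp
    have hδ0 : 0 < ε / c := by rw [hδ]; positivity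
    have h1 : e < ε / c := by
      rw [hδ]
      nlinarith
    have h2 : 2 * (ε / c) ≤ ε := by
      rw [mul_div_assoc', div_le_iff₀ hc0]
      have : 0 < ε := by positivity
      nlinarith
    have hinc := localWidth_sub_le_of_lipschitz hc hL hK hconv hσ hμ (by linarith : e < ε)
      (hlip (ε / c) hδ0 (by rw [hδ]; nlinarith))
    refine (lintegral_lse_le hK hconv hσ hμ hδ0 h2 (by linarith) hinc).trans_eq ?_
    congr 1
    rw [hε]
    ring

end Characterization

end GaussianSequence

theorem corollary2p18 :
    ∃ c₀ : ℝ, 0 < c₀ ∧ ∀ c : ℝ, c₀ ≤ c →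
      (∀ A : ℝ, 0 < A → ∃ a L : ℝ, 0 < a ∧ 0 < L ∧
        ∀ (n : ℕ) (K : Set (EuclideanSpace ℝ (Fin n))) (σ : ℝ),
          IsClosed K → Convex ℝ K → K.Nonempty → 0 < σ →
          GaussianSequence.LSEOptimal A σ K → GaussianSequence.WidthLipschitz c a L σ K) ∧
      (∀ a L : ℝ, 0 < a → 0 < L → ∃ A : ℝ, 0 < A ∧
        ∀ (n : ℕ) (K : Set (EuclideanSpace ℝ (Fin n))) (σ : ℝ),
          IsClosed K → Convex ℝ K → K.Nonempty → 0 < σ →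
          GaussianSequence.WidthLipschitz c a L σ K → GaussianSequence.LSEOptimal A σ K) := by
  refine ⟨17, by norm_num, fun c hc => ⟨fun A hA => ?_, fun a L ha hL => ?_⟩⟩
  · have hc0 : 0 < c := by linarith
    exact ⟨2 * (1 + 128 * (1 + A) * c), 29, by positivity, by norm_num,
      fun n K σ hK hconv hne hσ h =>
        GaussianSequence.widthLipschitz_of_lseOptimal hc hA hK hconv hne hσ h⟩
  · have hc0 : 0 < c := by linarith
    exact ⟨_, by positivity, fun n K σ hK hconv hne hσ h =>
      GaussianSequence.lseOptimal_of_widthLipschitz hc ha hL hK hconv hne hσ h⟩
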